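/- Let $\mu\neq 0$ be a real (signed) finite Borel measure on $(0,\infty)$ with $\mu((0,\infty))=0$, and let $F(z)=\int_0^\infty e^{-z\xi}\,d\mu(\xi)$ $(\operatorname{Re} z\ge 0)$ be its Laplace transform. Let $X$ be a complex Banach space and let $(T(t))_{t>0}$ be a semigroup of bounded operators on $X$ (that is, $T(s+t)=T(s)T(t)$ for all $s,t>0$) such that $t\mapsto T(t)x$ is continuous on $(0,\infty)$ for every $x\in X$, every $T(t)$ has spectral radius $0$, and $T(t)\ne 0$ for some $t>0$. Write $A$ for its generator and, for $s>0$, let $$F(-sA)x=\int_0^\infty T(s\xi)x\,d\mu(\xi)\qquad(x\in X),$$ where $F(-sA)$ is said to be defined if this Bochner integral exists (with respect to $|\mu|$) for every $x\in X$. (a) If $|\mu|((0,a))=0$ for some $a>0$ (in particular, if $\mu$ has compact support in $(0,\infty)$), or if $\sup_{0<t<a}\|T(t)\|<\infty$ for some $a>0$, then $F(-sA)$ is defined for every $s>0$. (b) The maximum $\max_{x\ge 0}|F(x)|$ is attained, and there exists $\eta>0$ such that for every $s\in(0,\eta]$ for which $F(-sA)$ is defined, $F(-sA)$ is a bounded linear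 operator on $X$ and $$\|F(-sA)\|>\max_{x\ge 0}|F(x)| .$$ -/

import Mathlib

open MeasureTheory Set

noncomputable section

/-- The Laplace transform `z ↦ ∫ e^{-zξ} dμ(ξ)` of a real finite Borel measure `μ` on `(0, ∞)`. -/
def laplaceTransform (μ : SignedMeasure (Ioi (0 : ℝ))) (z : ℂ) : ℂ :=
  ∫ᵛ ξ : Ioi (0 : ℝ), Complex.exp (-(z * ((ξ : ℝ) : ℂ))) ∂<•μ

variable {X : Type*} [NormedAddCommGroup X] [NormedSpace ℂ X]

/-- `(T(t))_{t > 0}` is a semigroup of bounded operators which is strongly continuous on `(0, ∞)`.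
Nothing is required at the origin, and the values of `T` at `t ≤ 0` play no role. -/
structure IsStronglyContinuousSemigroup (T : ℝ → X →L[ℂ] X) : Prop where
  map_add : ∀ s t : ℝ, 0 < s → 0 < t → T (s + t) = T s * T t
  continuousOn : ∀ x : X, ContinuousOn (fun t : ℝ => T t x) (Ioi 0)

/-- Every element of the semigroup has spectral radius `0`. -/
def IsQuasinilpotentSemigroup (T : ℝ → X →L[ℂ] X) : Prop :=
  ∀ t : ℝ, 0 < t → spectralRadius ℂ (T t) = 0

/-- The Bochner integrals `∫ T(sξ)x dμ(ξ)` that define `F(-sA)` exist for all `x`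
(`μ.Integrable f` is Bochner integrability of `f` with respect to the variation `|μ|`). -/
def IsFunctionalCalculusDefined (μ : SignedMeasure (Ioi (0 : ℝ))) (T : ℝ → X →L[ℂ] X)
    (s : ℝ) : Prop :=
  ∀ x : X, μ.Integrable (fun ξ : Ioi (0 : ℝ) => T (s * (ξ : ℝ)) x)

/-- The map `F(-sA) : x ↦ ∫ T(sξ)x dμ(ξ)`, where `F` is the Laplace transform of `μ` and `A` is
the generator of `T` (so that `sA` is the generator of `t ↦ T(st)`). -/
def functionalCalculus (μ : SignedMeasure (Ioi (0 : ℝ))) (T : ℝ → X →L[ℂ] X) (s : ℝ) (x : X) : X :=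
  ∫ᵛ ξ : Ioi (0 : ℝ), T (s * (ξ : ℝ)) x ∂<•μ

end

/-! Suppose `‖F(-sA)‖ ≤ M = max |F|` for arbitrarily small `s`; the claim is that then every `T t₀`
is zero. For an orbit `f(t) = T(t + δ)x`, quasinilpotency gives decay faster than every exponential,
so `J(z) = ∫ e^{zt} f(t) dt` is entire, and it is bounded on the left half-plane. A shift of the
orbit shows that `T(a)` acts on `J(z)` as multiplication by `e^{-za}` up to an error bounded
uniformly for `Re z ≥ 0`. Integrating against `μ`, `F(-sA)` acts as multiplication by `F(sz)` up to
a bounded error (`norm_laplaceTransform_smul_sub_functionalCalculus_le`), whence `(|F(sz)| - M)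
‖J(z)‖` is bounded wherever `|F(sz)| > M`.

The geometric half turns this into a bound on a whole half-disc. Let `|F|` attain `M` at `x₀ > 0` on
the real axis. Because `F` is real there, it exceeds `M` along some ray from `x₀` into the upper
half-plane, and a Phragmén–Lindelöf argument continues this ray to the imaginary axis inside `{|F| >
M}` (`exists_compact_joinedIn_peak`). The arc and its mirror image enclose, with the imaginary axis,
a bounded region containing a half-disc about `0`. The maximum principle there, with a factor `(z -
x₀)^m` absorbing the singularity at `x₀`, bounds `J(z/s)` on the half-disc independently of `s`
(`exists_halfDisc_uniform_bound`).

As `s → 0` the rescaled half-discs exhaust the right half-plane, so `J` is bounded, constant by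
Liouville, and zero by its limit at `-∞`. The orbit then vanishes. -/

/-! ### Plane topology: components, continuous logarithms and crossing paths. -/

/-- The frontier of a connected component of an open set does not meet that open set. -/
theorem IsOpen.notMem_of_mem_frontier_connectedComponentIn {α : Type*} [TopologicalSpace α]
    [LocallyConnectedSpace α] {U : Set α} (hU : IsOpen U) {x w : α}
    (hw : w ∈ frontier (connectedComponentIn U x)) : w ∉ U := by
  intro hwU
  have hopen : IsOpen (connectedComponentIn U x) := hU.connectedComponentIn
  have hwo : IsOpen (connectedComponentIn U w) := hU.connectedComponentIn
  obtain ⟨y, hy1, hy2⟩ := mem_closure_iff.1 hw.1 _ hwo (mem_connectedComponentIn hwU)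
  have h : w ∈ connectedComponentIn U x := by
    rw [connectedComponentIn_eq hy2, ← connectedComponentIn_eq hy1]
    exact mem_connectedComponentIn hwU
  exact hw.2 (by rwa [hopen.interior_eq])

/-- Two continuous logarithms of a path, one of which is taken after a rotation of the path into
the slit plane, have the same increment. -/
theorem sub_eq_log_sub_log_of_exp_eq {f g : ℝ → ℂ} (c : ℂ) (hf : Continuous f) (hg : Continuous g)
    (hfg : ∀ s, Complex.exp (f s) = g s)
    (hc : ∀ s ∈ Icc (0 : ℝ) 1, c * g s ∈ Complex.slitPlane) :
    f 1 - f 0 = Complex.log (c * g 1) - Complex.log (c * g 0) := by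
  have h0 : (0 : ℝ) ∈ Icc (0 : ℝ) 1 := by simp
  have h1 : (1 : ℝ) ∈ Icc (0 : ℝ) 1 := by simp
  have hcne : c ≠ 0 := by
    rintro rfl
    simpa using hc 0 h0
  -- The two logarithms differ from a constant by `2πi` times this function, which is continuous and
  -- integer-valued, hence constant on `[0, 1]`.
  set φ : ℝ → ℂ := fun s =>
    (f s - Complex.log (c * g s) + Complex.log c) / (2 * Real.pi * Complex.I) with hφ
  have hcont : ContinuousOn φ (Icc 0 1) := by
    refine ContinuousOn.div_const ?_ _
    refine ContinuousOn.add (ContinuousOn.sub hf.continuousOn ?_) continuousOn_const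
    exact ContinuousOn.clog (by fun_prop) hc
  have hmaps : MapsTo φ (Icc 0 1) (range (Int.cast : ℤ → ℂ)) := by
    intro s hs
    have hgs : g s ≠ 0 := by
      rw [← hfg]
      exact Complex.exp_ne_zero _
    have : Complex.exp (f s - Complex.log (c * g s) + Complex.log c) = 1 := by
      rw [Complex.exp_add, Complex.exp_sub, hfg, Complex.exp_log (mul_ne_zero hcne hgs),
        Complex.exp_log hcne]
      field_simp
    obtain ⟨n, hn⟩ := Complex.exp_eq_one_iff.1 this
    refine ⟨n, ?_⟩
    rw [hφ]
    simp only [hn]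
    rw [mul_div_cancel_right₀ _ Complex.two_pi_I_ne_zero]
  have hdisc : IsDiscrete (range (Int.cast : ℤ → ℂ)) := by
    have := Complex.isClosedEmbedding_intCast.isEmbedding
    exact this.isInducing.isDiscrete_range
  have h := isPreconnected_Icc.constant_of_mapsTo hdisc hcont hmaps h0 h1
  simp only [hφ] at h
  rw [div_left_inj' Complex.two_pi_I_ne_zero] at h
  linear_combination -h

/-- A path in the upper half-plane that joins two real points and stays on the right of the
imaginary axis meets every path in the closed upper half-plane that joins a point of the positive
imaginary axis to a real point between them. -/
theorem exists_eq_of_crossing {p γ : ℝ → ℂ} (hp : Continuous p) (hγ : Continuous γ)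
    {a b x₀ y₀ : ℝ} (hax : a < x₀) (hxb : x₀ < b) (hy : 0 < y₀)
    (hp0 : p 0 = a) (hp1 : p 1 = b) (hγ0 : γ 0 = y₀ * Complex.I) (hγ1 : γ 1 = x₀)
    (hpim : ∀ s, 0 ≤ (p s).im) (hpre : ∀ s, 0 < (p s).re) (hγim : ∀ s, 0 ≤ (γ s).im) :
    ∃ s t, p s = γ t := by
  by_contra! hne
  have ha : 0 < a := by simpa [hp0] using hpre 0
  have hb : 0 < b := by simpa [hp1] using hpre 1
  -- If the paths never meet, their difference is a nonvanishing function on the simply connected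
  -- parameter plane and has a continuous logarithm there.
  obtain ⟨f, hf, hfe⟩ := Complex.exists_continuousOn_eqOn_exp_comp (X := ℝ × ℝ) (U := univ)
    (Homeomorph.Set.univ (ℝ × ℝ)).toHomotopyEquiv.simplyConnectedSpace isOpen_univ
    (g := fun q => p q.1 - γ q.2) (by fun_prop)
    (by
      rintro ⟨q, -, hq⟩
      exact hne _ _ (sub_eq_zero.1 hq))
  rw [continuousOn_univ] at hf
  have hexp : ∀ s t, Complex.exp (f (s, t)) = p s - γ t := fun s t => hfe (mem_univ (s, t))
  have hup : ∀ z : ℂ, z ≠ 0 → 0 ≤ z.im → -Complex.I * z ∈ Complex.slitPlane := by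
    intro z hz him
    rw [Complex.mem_slitPlane_iff]
    by_cases h : 0 < z.im
    · left; simpa using h
    · right
      have h0 : z.im = 0 := le_antisymm (not_lt.1 h) him
      intro h'
      apply hz
      apply Complex.ext <;> simp_all
  have hdown : ∀ z : ℂ, z ≠ 0 → z.im ≤ 0 → Complex.I * z ∈ Complex.slitPlane := by
    intro z hz him
    have := hup (-z) (neg_ne_zero.2 hz) (by simpa using him)
    simpa using this
  have hsub : ∀ s t, p s - γ t ≠ 0 := fun s t => sub_ne_zero.2 (hne s t)
  -- On each side of the unit parameter square the difference stays in a half-plane, so a rotated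
  -- principal logarithm computes the increment of `f`.
  have e1 := sub_eq_log_sub_log_of_exp_eq (-Complex.I) (f := fun s => f (s, 1))
    (g := fun s => p s - γ 1) (by fun_prop) (by fun_prop) (fun s => hexp s 1)
    (fun s _ => hup _ (hsub _ _) (by simpa [hγ1] using hpim s))
  have e2 := sub_eq_log_sub_log_of_exp_eq 1 (f := fun s => f (s, 0))
    (g := fun s => p s - γ 0) (by fun_prop) (by fun_prop) (fun s => hexp s 0)
    (fun s _ => by
      rw [Complex.mem_slitPlane_iff]
      left
      simpa [hγ0] using hpre s)
  have e3 := sub_eq_log_sub_log_of_exp_eq Complex.I (f := fun t => f (1, t))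
    (g := fun t => p 1 - γ t) (by fun_prop) (by fun_prop) (fun t => hexp 1 t)
    (fun t _ => hdown _ (hsub _ _) (by simpa [hp1] using hγim t))
  have e4 := sub_eq_log_sub_log_of_exp_eq Complex.I (f := fun t => f (0, t))
    (g := fun t => p 0 - γ t) (by fun_prop) (by fun_prop) (fun t => hexp 0 t)
    (fun t _ => hdown _ (hsub _ _) (by simpa [hp0] using hγim t))
  simp only [hp0, hp1, hγ0, hγ1] at e1 e2 e3 e4
  have i1 := congrArg Complex.im e1
  have i2 := congrArg Complex.im e2
  have i3 := congrArg Complex.im e3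
  have i4 := congrArg Complex.im e4
  simp only [Complex.sub_im, Complex.log_im, one_mul] at i1 i2 i3 i4
  have hpi := Real.pi_pos
  have a1 : Complex.arg (-Complex.I * ((b : ℂ) - x₀)) = -(Real.pi / 2) := by
    rw [show -Complex.I * ((b : ℂ) - x₀) = ((b - x₀ : ℝ) : ℂ) * (-Complex.I) by push_cast; ring,
      Complex.arg_real_mul _ (by linarith), Complex.arg_neg_I]
  have a2 : Complex.arg (-Complex.I * ((a : ℂ) - x₀)) = Real.pi / 2 := by
    rw [show -Complex.I * ((a : ℂ) - x₀) = ((x₀ - a : ℝ) : ℂ) * Complex.I by push_cast; ring,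
      Complex.arg_real_mul _ (by linarith), Complex.arg_I]
  have a3 : Complex.arg (Complex.I * ((b : ℂ) - x₀)) = Real.pi / 2 := by
    rw [show Complex.I * ((b : ℂ) - x₀) = ((b - x₀ : ℝ) : ℂ) * Complex.I by push_cast; ring,
      Complex.arg_real_mul _ (by linarith), Complex.arg_I]
  have a4 : Complex.arg (Complex.I * ((a : ℂ) - x₀)) = -(Real.pi / 2) := by
    rw [show Complex.I * ((a : ℂ) - x₀) = ((x₀ - a : ℝ) : ℂ) * (-Complex.I) by push_cast; ring,
      Complex.arg_real_mul _ (by linarith), Complex.arg_neg_I]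
  have harg1 : ∀ r : ℝ, 0 < r → -(Real.pi / 2) < Complex.arg (r - y₀ * Complex.I) ∧
      Complex.arg (r - y₀ * Complex.I) < 0 := by
    intro r hr
    have h1 := Complex.abs_arg_lt_pi_div_two_iff (z := r - y₀ * Complex.I) |>.2
      (Or.inl (by simpa using hr))
    refine ⟨(abs_lt.1 h1).1, Complex.arg_neg_iff.2 (by simpa using hy)⟩
  have harg2 : ∀ r : ℝ, 0 < r → 0 ≤ Complex.arg (Complex.I * (r - y₀ * Complex.I)) ∧
      Complex.arg (Complex.I * (r - y₀ * Complex.I)) < Real.pi / 2 := by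
    intro r hr
    have h1 := Complex.abs_arg_lt_pi_div_two_iff (z := Complex.I * (r - y₀ * Complex.I)) |>.2
      (Or.inl (by simpa using hy))
    refine ⟨Complex.arg_nonneg_iff.2 (by simpa using hr.le), (abs_lt.1 h1).2⟩
  obtain ⟨u1, u2⟩ := harg1 a ha
  obtain ⟨u3, u4⟩ := harg1 b hb
  obtain ⟨v1, v2⟩ := harg2 a ha
  obtain ⟨v3, v4⟩ := harg2 b hb
  rw [a1, a2] at i1
  rw [a3] at i3
  rw [a4] at i4
  -- Two routes from `(0, 0)` to `(1, 1)` give different changes of argument: at most `-3π/2`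
  -- through `(0, 1)`, more than `-π/2` through `(1, 0)`.
  linarith

/-! ### The set where `|F|` exceeds its maximum on the real axis. -/

/-- If the restriction to the real axis of a nonconstant analytic function is real and has a local
maximum at `x₀`, then its real part increases at least like a power of the distance to `x₀` along
some ray issuing from `x₀` into the upper half-plane. -/
theorem AnalyticAt.exists_ray_le_re_of_isLocalMax {F : ℂ → ℂ} {x₀ M : ℝ} (hF : AnalyticAt ℂ F x₀)
    (hx₀ : F x₀ = M)
    (hmax : ∀ᶠ x : ℝ in nhds x₀, (F x).im = 0 ∧ (F x).re ≤ M)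
    (hconst : ¬ ∀ᶠ z in nhds (x₀ : ℂ), F z = M) :
    ∃ (m : ℕ) (c δ : ℝ) (u : ℂ), m ≠ 0 ∧ 0 < c ∧ 0 < δ ∧ 0 < u.im ∧ ‖u‖ = 1 ∧
      ∀ r : ℝ, 0 < r → r < δ → M + c * r ^ m ≤ (F (x₀ + r * u)).re := by
  obtain ⟨m, g, hg, hg0, hFg⟩ := (AnalyticAt.exists_eventuallyEq_pow_smul_nonzero_iff
    (f := fun z => F z - M) (z₀ := (x₀ : ℂ)) (by fun_prop)).2 (by simpa [sub_eq_zero] using hconst)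
  -- With `F - M = (z - x₀)^m g`, approaching `x₀` from the right puts `g x₀` in this closed ray,
  -- and from the left `(-1)^m g x₀`; hence `m` is even.
  set S : Set ℂ := {z | z.im = 0 ∧ z.re ≤ 0} with hS
  have hSclosed : IsClosed S :=
    (isClosed_eq Complex.continuous_im continuous_const).inter
      (isClosed_le Complex.continuous_re continuous_const)
  have hreal : Filter.Tendsto (fun x : ℝ => (x : ℂ)) (nhds x₀) (nhds (x₀ : ℂ)) :=
    Complex.continuous_ofReal.continuousAt
  have hgcont : Filter.Tendsto (fun x : ℝ => g x) (nhds x₀) (nhds (g x₀)) :=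
    hg.continuousAt.tendsto.comp hreal
  have hFgr : ∀ᶠ x : ℝ in nhds x₀, (((x - x₀) ^ m : ℝ) : ℂ) * g x ∈ S := by
    filter_upwards [hreal.eventually hFg, hmax] with x h1 h2
    have : (((x - x₀) ^ m : ℝ) : ℂ) * g x = F x - M := by
      rw [h1]; push_cast; rfl
    rw [this]
    refine ⟨by simp [h2.1], by simpa using h2.2⟩
  have hscale : ∀ (t : ℝ) (z : ℂ), 0 < t → (t : ℂ) * z ∈ S → z ∈ S := by
    rintro t z ht ⟨h1, h2⟩
    rw [Complex.re_ofReal_mul] at h2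
    rw [Complex.im_ofReal_mul] at h1
    exact ⟨(mul_eq_zero.1 h1).resolve_left ht.ne', nonpos_of_mul_nonpos_right h2 ht⟩
  have hright : g x₀ ∈ S := by
    refine hSclosed.mem_of_tendsto (hgcont.mono_left (nhdsWithin_le_nhds (s := Ioi x₀))) ?_
    filter_upwards [nhdsWithin_le_nhds hFgr, self_mem_nhdsWithin] with x hx hx'
    exact hscale _ _ (pow_pos (sub_pos.2 hx') m) hx
  have hneg : (g x₀).re < 0 := by
    refine lt_of_le_of_ne hright.2 fun h => hg0 ?_
    exact Complex.ext h hright.1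
  have hleft : (((-1) ^ m : ℝ) : ℂ) * g x₀ ∈ S := by
    refine hSclosed.mem_of_tendsto
      ((hgcont.mono_left (nhdsWithin_le_nhds (s := Iio x₀))).const_mul _) ?_
    filter_upwards [nhdsWithin_le_nhds hFgr, self_mem_nhdsWithin] with x hx hx'
    refine hscale _ _ (pow_pos (sub_pos.2 hx') m) ?_
    convert hx using 1
    rw [← mul_assoc, ← Complex.ofReal_mul, ← mul_pow]
    congr 3
    ring
  have heven : Even m := by
    by_contra hodd
    rw [Nat.not_even_iff_odd] at hodd
    rw [hodd.neg_one_pow] at hleft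
    have := hleft.2
    simp at this
    linarith
  have hm0 : m ≠ 0 := by
    rintro rfl
    have := hFg.self_of_nhds
    simp [hx₀] at this
    exact hg0 this.symm
  have hm2 : 2 ≤ m := by
    obtain ⟨k, hk⟩ := heven
    omega
  -- This direction has `u ^ m = -1`, which turns the decrease of `F` along the real axis into an
  -- increase; `m ≥ 2` places it in the upper half-plane.
  set θ : ℝ := Real.pi / m with hθ
  have hmpos : (0 : ℝ) < m := by positivity
  set u : ℂ := Complex.exp (θ * Complex.I) with hu
  have hum : u ^ m = -1 := by
    rw [hu, ← Complex.exp_nat_mul, hθ]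
    push_cast
    rw [← mul_assoc, mul_div_cancel₀ _ (by exact_mod_cast hm0), Complex.exp_pi_mul_I]
  have huim : 0 < u.im := by
    rw [hu, Complex.exp_ofReal_mul_I_im]
    refine Real.sin_pos_of_pos_of_lt_pi (by positivity) ?_
    rw [hθ, div_lt_iff₀ hmpos]
    have : (2 : ℝ) ≤ m := by exact_mod_cast hm2
    nlinarith [Real.pi_pos]
  have hray : Filter.Tendsto (fun r : ℝ => (x₀ : ℂ) + r * u) (nhds 0) (nhds (x₀ : ℂ)) := by
    have : ContinuousAt (fun r : ℝ => (x₀ : ℂ) + r * u) 0 := by fun_prop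
    simpa [ContinuousAt] using this
  have hgre : ∀ᶠ z in nhds (x₀ : ℂ), (g z).re < (g x₀).re / 2 := by
    have h1 : Filter.Tendsto (fun z => (g z).re) (nhds (x₀ : ℂ)) (nhds (g x₀).re) :=
      (Complex.continuous_re.tendsto _).comp hg.continuousAt
    exact h1.eventually (gt_mem_nhds (by linarith))
  obtain ⟨δ, hδ, hball⟩ := Metric.eventually_nhds_iff.1 (hray.eventually (hFg.and hgre))
  refine ⟨m, -(g x₀).re / 2, δ, u, hm0, by linarith, hδ, huim, Complex.norm_exp_ofReal_mul_I θ, ?_⟩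
  intro r hr hrδ
  obtain ⟨h1, h2⟩ := hball (y := r) (by simpa [abs_of_pos hr] using hrδ)
  have h3 : F (x₀ + r * u) = M - ((r ^ m : ℝ) : ℂ) * g (x₀ + r * u) := by
    have : F (x₀ + r * u) = M + (r * u) ^ m * g (x₀ + r * u) := by
      rw [← sub_eq_iff_eq_add', h1, smul_eq_mul, add_sub_cancel_left]
    rw [this, mul_pow, hum]
    push_cast
    ring
  rw [h3, Complex.sub_re, Complex.ofReal_re, Complex.re_ofReal_mul]
  have := pow_pos hr m
  nlinarith

/-- A bounded analytic function on a subset of the right half-plane is bounded by its bound on the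
frontier. -/
theorem norm_le_of_frontier_of_bounded_of_re_pos {F : ℂ → ℂ} {U : Set ℂ} {M N : ℝ} (hM : 0 < M)
    (hU : ∀ z ∈ U, 0 ≤ z.re) (hF : DiffContOnCl ℂ F U)
    (hN : ∀ z ∈ closure U, ‖F z‖ ≤ N) (hfr : ∀ z ∈ frontier U, ‖F z‖ ≤ M) {z : ℂ} (hz : z ∈ U) :
    ‖F z‖ ≤ M := by
  have hcl : ∀ w ∈ closure U, 0 ≤ w.re := fun w hw =>
    closure_minimal (s := U) (t := {w | 0 ≤ w.re}) hU
      (isClosed_le continuous_const Complex.continuous_re) hw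
  have hone : ∀ w ∈ closure U, 1 ≤ ‖w + 1‖ := fun w hw =>
    le_trans (by simpa using hcl w hw) (Complex.re_le_norm (w + 1))
  have hne : ∀ w ∈ closure U, w + 1 ≠ 0 := fun w hw => by
    rw [← norm_pos_iff]
    linarith [hone w hw]
  -- Dividing `F ^ n` by `w + 1`, whose modulus is at least `1`, makes it small on large circles, so
  -- the maximum principle applies on a truncation of `U`. The factor `‖z + 1‖` disappears on taking
  -- `n`-th roots as `n → ∞`.
  have key : ∀ n : ℕ, ‖F z‖ ^ n ≤ M ^ n * ‖z + 1‖ := by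
    intro n
    set R : ℝ := max (‖z‖ + 1) (N ^ n / M ^ n + 1) with hR
    set V : Set ℂ := U ∩ Metric.ball 0 R with hV
    set G : ℂ → ℂ := fun w => F w ^ n / (w + 1) with hG
    have hVU : closure V ⊆ closure U := closure_mono inter_subset_left
    have hzV : z ∈ V := ⟨hz, by
      rw [mem_ball_zero_iff]
      exact lt_of_lt_of_le (by linarith) (le_max_left _ _)⟩
    have hGd : DiffContOnCl ℂ G V := by
      constructor
      · refine ((hF.differentiableOn.mono inter_subset_left).pow n).div (by fun_prop) ?_
        exact fun w hw => hne w (subset_closure hw.1)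
      · refine ((hF.continuousOn.mono hVU).pow n).div (by fun_prop) ?_
        exact fun w hw => hne w (hVU hw)
    have hbd : ∀ w ∈ frontier V, ‖G w‖ ≤ M ^ n := by
      intro w hw
      have hwcl : w ∈ closure U := hVU hw.1
      have h1 := hone w hwcl
      rw [hG]
      simp only [norm_div, norm_pow]
      rw [div_le_iff₀ (by linarith)]
      rcases (frontier_inter_subset _ _ hw) with h | h
      · calc ‖F w‖ ^ n ≤ M ^ n := by gcongr; exact hfr w h.1
          _ ≤ M ^ n * ‖w + 1‖ := le_mul_of_one_le_right (by positivity) h1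
      · have hwR : ‖w‖ = R := by
          have := Metric.frontier_ball_subset_sphere h.2
          simpa using this
        have h2 : R - 1 ≤ ‖w + 1‖ := by
          have := norm_sub_norm_le w (-1)
          simp only [norm_neg, norm_one, sub_neg_eq_add] at this
          linarith
        have h3 : N ^ n / M ^ n ≤ ‖w + 1‖ := by
          have := le_max_right (‖z‖ + 1) (N ^ n / M ^ n + 1)
          linarith
        calc ‖F w‖ ^ n ≤ N ^ n := by gcongr; exact hN w hwcl
          _ ≤ M ^ n * ‖w + 1‖ := by
            rw [div_le_iff₀ (by positivity)] at h3
            linarith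
    have h := Complex.norm_le_of_forall_mem_frontier_norm_le
      (Metric.isBounded_ball.subset inter_subset_right) hGd hbd (subset_closure hzV)
    rw [hG] at h
    simp only [norm_div, norm_pow] at h
    rwa [div_le_iff₀ (by linarith [hone z (subset_closure hz)])] at h
  by_contra! hlt
  have hq : 1 < ‖F z‖ / M := (one_lt_div hM).2 hlt
  obtain ⟨n, hn⟩ := pow_unbounded_of_one_lt ‖z + 1‖ hq
  rw [div_pow, lt_div_iff₀ (by positivity)] at hn
  linarith [key n]

/-- Let `F` be bounded and continuous on the closed right half-plane, analytic in its interior,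
and bounded by `M` on the real axis. Every point of the open first quadrant where `M < ‖F‖` can be
joined to the imaginary axis within the set where `M < ‖F‖`. -/
theorem exists_joinedIn_imaginary_axis {F : ℂ → ℂ} {M N : ℝ} (hM : 0 < M)
    (hd : DifferentiableOn ℂ F {z | 0 < z.re}) (hc : ContinuousOn F {z | 0 ≤ z.re})
    (hN : ∀ z : ℂ, 0 ≤ z.re → ‖F z‖ ≤ N) (hreal : ∀ x : ℝ, 0 ≤ x → ‖F x‖ ≤ M)
    {p : ℂ} (hpre : 0 < p.re) (hpim : 0 < p.im) (hp : M < ‖F p‖) :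
    ∃ y₀ : ℝ, 0 < y₀ ∧ JoinedIn {z | 0 ≤ z.re ∧ 0 ≤ z.im ∧ M < ‖F z‖} (y₀ * Complex.I) p := by
  set Q : Set ℂ := {z | 0 < z.re} ∩ {z | M < ‖F z‖} ∩ {z | 0 < z.im} with hQ
  have hre_open : IsOpen {z : ℂ | 0 < z.re} := isOpen_lt continuous_const Complex.continuous_re
  have hQopen : IsOpen Q :=
    ((hd.continuousOn.norm.isOpen_inter_preimage hre_open isOpen_Ioi)).inter
      (isOpen_lt continuous_const Complex.continuous_im)
  have hpQ : p ∈ Q := ⟨⟨hpre, hp⟩, hpim⟩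
  set Ω : Set ℂ := connectedComponentIn Q p with hΩ
  have hΩQ : Ω ⊆ Q := connectedComponentIn_subset Q p
  have hΩopen : IsOpen Ω := hQopen.connectedComponentIn
  have hpΩ : p ∈ Ω := mem_connectedComponentIn hpQ
  have hconn : IsConnected Ω := isConnected_connectedComponentIn_iff.2 hpQ
  have hclre : ∀ w ∈ closure Ω, 0 ≤ w.re := fun w hw =>
    closure_minimal (t := {w : ℂ | 0 ≤ w.re}) (fun z hz => show (0 : ℝ) ≤ z.re from le_of_lt (hΩQ hz).1.1)
      (isClosed_le continuous_const Complex.continuous_re) hw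
  have hclim : ∀ w ∈ closure Ω, 0 ≤ w.im := fun w hw =>
    closure_minimal (t := {w : ℂ | 0 ≤ w.im}) (fun z hz => show (0 : ℝ) ≤ z.im from le_of_lt (hΩQ hz).2)
      (isClosed_le continuous_const Complex.continuous_im) hw
  -- Otherwise Phragmén–Lindelöf would give `‖F p‖ ≤ M`. Such a frontier point is not real, since
  -- `‖F‖ ≤ M` there, and not in the open quadrant, where it would lie in `Q`; so it is on the
  -- imaginary axis.
  obtain ⟨w, hw, hwM⟩ : ∃ w ∈ frontier Ω, M < ‖F w‖ := by
    by_contra! hcon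
    have := norm_le_of_frontier_of_bounded_of_re_pos hM (fun z hz => (hΩQ hz).1.1.le)
      ⟨hd.mono fun z hz => (hΩQ hz).1.1, hc.mono hclre⟩ (fun z hz => hN z (hclre z hz)) hcon hpΩ
    linarith
  have hwre := hclre w hw.1
  have hwim := hclim w hw.1
  have hwim' : 0 < w.im := by
    refine lt_of_le_of_ne hwim fun h => ?_
    have : w = (w.re : ℂ) := Complex.ext rfl (by simpa using h.symm)
    rw [this] at hwM
    linarith [hreal _ hwre]
  have hwre' : w.re = 0 := by
    by_contra h
    exact hQopen.notMem_of_mem_frontier_connectedComponentIn hw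
      ⟨⟨lt_of_le_of_ne hwre (Ne.symm h), hwM⟩, hwim'⟩
  have hwI : w = w.im * Complex.I := by apply Complex.ext <;> simp [hwre']
  refine ⟨w.im, hwim', ?_⟩
  rw [← hwI]
  obtain ⟨δ, hδ, hball⟩ := Metric.mem_nhdsWithin_iff.1
    ((hc w hwre).norm.eventually (lt_mem_nhds hwM))
  obtain ⟨q, hqw, hqΩ⟩ := mem_closure_iff_nhds.1 hw.1 _ (Metric.ball_mem_nhds w hδ)
  have hseg : JoinedIn {z | 0 ≤ z.re ∧ 0 ≤ z.im ∧ M < ‖F z‖} w q := by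
    refine JoinedIn.of_segment_subset fun z hz => ?_
    have h1 : z ∈ Metric.ball w δ :=
      (convex_ball w δ).segment_subset (Metric.mem_ball_self hδ) hqw hz
    have h2 : (0 : ℝ) ≤ z.re :=
      (convex_halfSpace_re_ge 0).segment_subset (s := {z : ℂ | 0 ≤ z.re}) hwre
        (show (0 : ℝ) ≤ q.re from le_of_lt (hΩQ hqΩ).1.1) hz
    have h3 : (0 : ℝ) ≤ z.im :=
      (convex_halfSpace_im_ge 0).segment_subset (s := {z : ℂ | 0 ≤ z.im}) hwim
        (show (0 : ℝ) ≤ q.im from le_of_lt (hΩQ hqΩ).2) hz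
    exact ⟨h2, h3, hball ⟨h1, h2⟩⟩
  refine hseg.trans ?_
  have hpath : IsPathConnected Ω := hΩopen.isConnected_iff_isPathConnected.1 hconn
  exact (hpath.joinedIn q hqΩ p hpΩ).mono fun z hz =>
    ⟨le_of_lt (hΩQ hz).1.1, le_of_lt (hΩQ hz).2, (hΩQ hz).1.2⟩

/-- Under the assumptions of `exists_joinedIn_imaginary_axis`, if `M` is attained at `x₀ > 0`, then
there is a compact arc in the closed first quadrant from the imaginary axis to `x₀` on which
`‖F‖ - M` is bounded below by a power of the distance to `x₀`. -/
theorem exists_compact_joinedIn_peak {F : ℂ → ℂ} {M N x₀ : ℝ} (hM : 0 < M)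
    (hd : DifferentiableOn ℂ F {z | 0 < z.re}) (hc : ContinuousOn F {z | 0 ≤ z.re})
    (hN : ∀ z : ℂ, 0 ≤ z.re → ‖F z‖ ≤ N) (hreal : ∀ x : ℝ, 0 ≤ x → ‖F x‖ ≤ M)
    (him : ∀ x : ℝ, 0 ≤ x → (F x).im = 0) (hx₀ : 0 < x₀) (hFx₀ : F x₀ = M)
    (hconst : ¬ ∀ᶠ z in nhds (x₀ : ℂ), F z = M) :
    ∃ (K : Set ℂ) (m : ℕ) (c y₀ : ℝ), IsCompact K ∧ m ≠ 0 ∧ 0 < c ∧ 0 < y₀ ∧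
      JoinedIn K (y₀ * Complex.I) x₀ ∧
      ∀ z ∈ K, 0 ≤ z.re ∧ 0 ≤ z.im ∧ M + c * ‖z - x₀‖ ^ m ≤ ‖F z‖ ∧ (z ≠ x₀ → M < ‖F z‖) := by
  have hre_open : IsOpen {z : ℂ | 0 < z.re} := isOpen_lt continuous_const Complex.continuous_re
  have hana : AnalyticAt ℂ F x₀ := hd.analyticAt (hre_open.mem_nhds (by simpa using hx₀))
  obtain ⟨m, c, δ, u, hm0, hc0, hδ, huim, hu1, hray⟩ := hana.exists_ray_le_re_of_isLocalMax hFx₀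
    (by
      filter_upwards [lt_mem_nhds hx₀] with x hx
      exact ⟨him x hx.le, (Complex.re_le_norm _).trans (hreal x hx.le)⟩) hconst
  -- The second bound keeps the initial segment of the ray in the right half-plane.
  set ρ : ℝ := min (δ / 2) (x₀ / 2) with hρ
  have hρ0 : 0 < ρ := lt_min (by linarith) (by linarith)
  have hρδ : ρ < δ := (min_le_left _ _).trans_lt (by linarith)
  have hρx : ρ ≤ x₀ / 2 := min_le_right _ _
  have hray_re : ∀ r : ℝ, 0 ≤ r → r ≤ ρ → 0 < ((x₀ : ℂ) + r * u).re := by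
    intro r hr hrρ
    have h1 : -1 ≤ u.re := by
      have := (abs_le.1 ((Complex.abs_re_le_norm u).trans hu1.le)).1
      exact this
    have : ((x₀ : ℂ) + r * u).re = x₀ + r * u.re := by simp
    rw [this]
    nlinarith
  have hray_im : ∀ r : ℝ, ((x₀ : ℂ) + r * u).im = r * u.im := by intro r; simp
  have hray_gt : ∀ r : ℝ, 0 < r → r ≤ ρ → M + c * r ^ m ≤ ‖F (x₀ + r * u)‖ := fun r h1 h2 =>
    (hray r h1 (by linarith)).trans (Complex.re_le_norm _)
  set p : ℂ := x₀ + ρ * u with hp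
  have hpM : M < ‖F p‖ := lt_of_lt_of_le (by have := pow_pos hρ0 m; nlinarith)
    (hray_gt ρ hρ0 le_rfl)
  obtain ⟨y₀, hy₀, hJ⟩ := exists_joinedIn_imaginary_axis hM hd hc hN hreal (p := p)
    (hray_re ρ hρ0.le le_rfl) (by rw [hray_im]; positivity) hpM
  set γ := hJ.somePath with hγ
  set K₁ : Set ℂ := range γ with hK₁
  have hK₁S : ∀ z ∈ K₁, 0 ≤ z.re ∧ 0 ≤ z.im ∧ M < ‖F z‖ := by
    rintro _ ⟨t, rfl⟩
    exact hJ.somePath_mem t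
  have hK₁c : IsCompact K₁ := isCompact_range γ.continuous
  have hray_seg : ∀ z ∈ segment ℝ (x₀ : ℂ) p, ∃ r : ℝ, 0 ≤ r ∧ r ≤ ρ ∧ z = x₀ + r * u := by
    intro z hz
    rw [segment_eq_image'] at hz
    obtain ⟨t, ⟨ht0, ht1⟩, rfl⟩ := hz
    refine ⟨t * ρ, by positivity, by nlinarith, ?_⟩
    simp only [hp, Complex.real_smul]
    push_cast
    ring
  -- Away from the ray, compactness suffices: `‖F‖ - M` has a positive minimum on `K₁`, and the
  -- distance to `x₀` is bounded.
  obtain ⟨c₁, hc₁, hK₁b⟩ : ∃ c₁ > 0, ∀ z ∈ K₁, M + c₁ * ‖z - x₀‖ ^ m ≤ ‖F z‖ := by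
    have hne : K₁.Nonempty := range_nonempty _
    obtain ⟨a, ha, hamin⟩ := hK₁c.exists_isMinOn hne
      (hc.norm.mono fun z hz => (hK₁S z hz).1)
    obtain ⟨b, hb, hbmax⟩ := hK₁c.exists_isMaxOn hne
      (f := fun z : ℂ => ‖z - x₀‖ ^ m) (by fun_prop)
    have haM := (hK₁S a ha).2.2
    have hb0 : 0 ≤ ‖b - x₀‖ ^ m := by positivity
    refine ⟨(‖F a‖ - M) / (‖b - x₀‖ ^ m + 1), div_pos (by linarith) (by positivity), ?_⟩
    intro z hz
    have h1 : ‖F a‖ ≤ ‖F z‖ := hamin hz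
    have h2 : ‖z - x₀‖ ^ m ≤ ‖b - x₀‖ ^ m := hbmax hz
    have h3 : (‖F a‖ - M) / (‖b - x₀‖ ^ m + 1) * ‖z - x₀‖ ^ m ≤ ‖F a‖ - M := by
      rw [div_mul_eq_mul_div, div_le_iff₀ (by positivity)]
      nlinarith
    linarith
  refine ⟨K₁ ∪ segment ℝ (x₀ : ℂ) p, m, min c₁ c, y₀, hK₁c.union ?_, hm0, lt_min hc₁ hc0, hy₀, ?_, ?_⟩
  · rw [segment_eq_image']
    exact isCompact_Icc.image (by fun_prop)
  · have h1 : JoinedIn K₁ (y₀ * Complex.I) p := ⟨γ, fun t => mem_range_self t⟩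
    have h2 : JoinedIn (segment ℝ (x₀ : ℂ) p) x₀ p := JoinedIn.of_segment_subset le_rfl
    exact (h1.mono subset_union_left).trans (h2.symm.mono subset_union_right)
  · rintro z (hz | hz)
    · obtain ⟨h1, h2, h3⟩ := hK₁S z hz
      refine ⟨h1, h2, le_trans ?_ (hK₁b z hz), fun _ => h3⟩
      gcongr
      exact min_le_left _ _
    · obtain ⟨r, hr0, hrρ, rfl⟩ := hray_seg z hz
      have hnorm : ‖(x₀ : ℂ) + r * u - x₀‖ = r := by
        rw [add_sub_cancel_left, norm_mul, hu1, mul_one, Complex.norm_real, Real.norm_eq_abs,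
          abs_of_nonneg hr0]
      refine ⟨(hray_re r hr0 hrρ).le, by rw [hray_im]; positivity, ?_, ?_⟩
      · rw [hnorm]
        rcases hr0.eq_or_lt with rfl | hr
        · simp [hm0, hFx₀, abs_of_pos hM]
        · refine le_trans ?_ (hray_gt r hr hrρ)
          gcongr
          exact min_le_right _ _
      · intro hne
        have hr : 0 < r := hr0.lt_of_ne (by rintro rfl; simp at hne)
        have := hray_gt r hr hrρ
        have := pow_pos hr m
        nlinarith

/-! ### The enclosed region and the uniform bound near the origin. -/

/-- A subset of the closed first quadrant which joins a point of the positive imaginary axis to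
`x₀ > 0` separates, together with its mirror image, the points of `(0, x₀)` from infinity within the
right half-plane. -/
theorem isBounded_connectedComponentIn_of_joinedIn {K : Set ℂ} {x₀ y₀ a : ℝ}
    (hKc : IsCompact K) (hK : ∀ z ∈ K, 0 ≤ z.im) (hy₀ : 0 < y₀)
    (hJ : JoinedIn K (y₀ * Complex.I) x₀) (ha : 0 < a) (hax : a < x₀)
    (haK : (a : ℂ) ∉ K) :
    Bornology.IsBounded
      (connectedComponentIn {z : ℂ | 0 < z.re ∧ z ∉ K ∧ (starRingEnd ℂ) z ∉ K} a) := by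
  set U : Set ℂ := {z : ℂ | 0 < z.re ∧ z ∉ K ∧ (starRingEnd ℂ) z ∉ K} with hU
  have hUopen : IsOpen U := by
    refine (isOpen_lt continuous_const Complex.continuous_re).inter (IsOpen.inter ?_ ?_)
    · exact hKc.isClosed.isOpen_compl
    · exact hKc.isClosed.isOpen_compl.preimage Complex.continuous_conj
  have haU : (a : ℂ) ∈ U := ⟨by simpa using ha, haK, by rwa [Complex.conj_ofReal]⟩
  obtain ⟨R, hR0, hKR⟩ := hKc.isBounded.exists_pos_norm_lt
  have hfar : ∀ z : ℂ, 0 < z.re → (R ≤ |z.re| ∨ R ≤ |z.im|) → z ∈ U := by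
    intro z hz hzR
    have h : R ≤ ‖z‖ := by
      rcases hzR with h | h
      · exact h.trans (Complex.abs_re_le_norm z)
      · exact h.trans (Complex.abs_im_le_norm z)
    refine ⟨hz, fun hzK => ?_, fun hzK => ?_⟩
    · linarith [hKR z hzK]
    · have := hKR _ hzK
      rw [Complex.norm_conj] at this
      linarith
  have hx₀R : x₀ < R := by
    have := hKR _ hJ.target_mem
    rw [Complex.norm_real, Real.norm_eq_abs] at this
    exact (le_abs_self _).trans_lt this
  -- `U` is symmetric under conjugation, so a path in it can be folded into the upper half-plane by
  -- `|im|` and still avoid `K`, contrary to the crossing lemma.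
  have hnot : ∀ b : ℝ, x₀ < b → ¬ JoinedIn U a b := by
    intro b hb hab
    set p := hab.somePath with hp
    set γ := hJ.somePath with hγ
    have hpU : ∀ s, p.extend s ∈ U := fun s => hab.somePath_mem _
    have hγK : ∀ s, γ.extend s ∈ K := fun s => hJ.somePath_mem _
    obtain ⟨s, t, hst⟩ := exists_eq_of_crossing
      (p := fun s => ((p.extend s).re : ℂ) + (|(p.extend s).im| : ℝ) * Complex.I)
      (γ := fun t => γ.extend t) (a := a) (b := b) (x₀ := x₀) (y₀ := y₀)
      (by have := p.continuous_extend; fun_prop) γ.continuous_extend hax hb hy₀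
      (by simp) (by simp) (by simp) (by simp)
      (fun s => by simp) (fun s => by simpa using (hpU s).1) (fun s => hK _ (hγK s))
    have hmem := hγK t
    rw [← hst] at hmem
    rcases abs_cases (p.extend s).im with ⟨h, -⟩ | ⟨h, -⟩
    · rw [h, Complex.re_add_im] at hmem
      exact (hpU s).2.1 hmem
    · rw [h] at hmem
      refine (hpU s).2.2 ?_
      convert hmem using 1
      apply Complex.ext <;> simp
  have hconn : IsPathConnected (connectedComponentIn U a) :=
    hUopen.connectedComponentIn.isConnected_iff_isPathConnected.1
      (isConnected_connectedComponentIn_iff.2 haU)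
  refine (Metric.isBounded_closedBall (x := (0 : ℂ)) (r := 2 * R)).subset fun v hv => ?_
  rw [mem_closedBall_zero_iff]
  by_contra! hvR
  have hvU : v ∈ U := connectedComponentIn_subset _ _ hv
  have hvre : 0 < v.re := hvU.1
  -- A point of norm above `2R` has a coordinate of size at least `R`, so it can move right and then
  -- vertically to the real axis without entering the disc that contains `K`.
  have hvbig : R ≤ v.re ∨ R ≤ |v.im| := by
    by_contra! h
    have := Complex.norm_le_abs_re_add_abs_im v
    rw [abs_of_pos hvre] at this
    linarith
  set b : ℝ := max v.re R with hb
  have hbR : R ≤ b := le_max_right _ _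
  have hbv : v.re ≤ b := le_max_left _ _
  have hb0 : 0 < b := hR0.trans_le hbR
  have h1 : JoinedIn U v (b + v.im * Complex.I) := by
    refine JoinedIn.of_segment_subset fun z hz => ?_
    rw [segment_eq_image'] at hz
    obtain ⟨t, ⟨ht0, ht1⟩, rfl⟩ := hz
    have hre : (v + t • ((b : ℂ) + v.im * Complex.I - v)).re = v.re + t * (b - v.re) := by simp
    have him : (v + t • ((b : ℂ) + v.im * Complex.I - v)).im = v.im := by simp
    have hge : v.re ≤ v.re + t * (b - v.re) := by nlinarith
    refine hfar _ (by rw [hre]; linarith) ?_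
    rw [hre, him]
    refine hvbig.imp (fun h => ?_) id
    exact h.trans (hge.trans (le_abs_self _))
  have h2 : JoinedIn U ((b : ℂ) + v.im * Complex.I) b := by
    refine JoinedIn.of_segment_subset fun z hz => ?_
    rw [segment_eq_image'] at hz
    obtain ⟨t, -, rfl⟩ := hz
    have hre : ((b : ℂ) + v.im * Complex.I + t • ((b : ℂ) - (b + v.im * Complex.I))).re = b := by
      simp
    exact hfar _ (by rw [hre]; exact hb0) (Or.inl (by rw [hre]; exact hbR.trans (le_abs_self _)))
  have h0 : JoinedIn U a v := (hconn.joinedIn _ (mem_connectedComponentIn haU) v hv).mono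
    (connectedComponentIn_subset _ _)
  exact hnot b (hx₀R.trans_le hbR) ((h0.trans h1).trans h2)

/-- Let `F` be bounded, continuous and symmetric on the closed right half-plane, analytic in its
interior, and let `M > 0` be the maximum of `F` on the positive real axis. Then there is a half-disc
about the origin on which every entire function `h` that is bounded on the imaginary axis and is
`O(1 / (‖F‖ - M))` where `M < ‖F‖` is bounded, uniformly in `h`. -/
theorem exists_halfDisc_uniform_bound {F : ℂ → ℂ} {M N x₀ : ℝ} (hM : 0 < M)
    (hd : DifferentiableOn ℂ F {z | 0 < z.re}) (hc : ContinuousOn F {z | 0 ≤ z.re})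
    (hN : ∀ z : ℂ, 0 ≤ z.re → ‖F z‖ ≤ N) (hreal : ∀ x : ℝ, 0 ≤ x → ‖F x‖ ≤ M)
    (hconj : ∀ z : ℂ, 0 ≤ z.re → F ((starRingEnd ℂ) z) = (starRingEnd ℂ) (F z))
    (hx₀ : 0 < x₀) (hFx₀ : F x₀ = M)
    (hconst : ¬ ∀ᶠ z in nhds (x₀ : ℂ), F z = M) :
    ∃ r C : ℝ, 0 < r ∧ ∀ (E : Type*) [NormedAddCommGroup E] [NormedSpace ℂ E] (h : ℂ → E)
      (B : ℝ), Differentiable ℂ h → 0 ≤ B → (∀ z : ℂ, z.re = 0 → ‖h z‖ ≤ B) →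
      (∀ z : ℂ, 0 ≤ z.re → M < ‖F z‖ → ‖h z‖ * (‖F z‖ - M) ≤ B) →
      ∀ z : ℂ, 0 < z.re → ‖z‖ < r → ‖h z‖ ≤ C * B := by
  have him : ∀ x : ℝ, 0 ≤ x → (F x).im = 0 := fun x hx => by
    have := hconj x (by simpa using hx)
    rw [Complex.conj_ofReal] at this
    exact Complex.conj_eq_iff_im.1 this.symm
  obtain ⟨K, m, c, y₀, hKc, hm0, hc0, hy₀, hJ, hKF⟩ :=
    exists_compact_joinedIn_peak hM hd hc hN hreal him hx₀ hFx₀ hconst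
  have hne : ∀ w ∈ K, (starRingEnd ℂ) w = w → w = x₀ := by
    intro w hw hww
    by_contra h
    have hwr : ((w.re : ℝ) : ℂ) = w := Complex.conj_eq_iff_re.1 hww
    have := (hKF w hw).2.2.2 h
    rw [← hwr] at this
    linarith [hreal _ (hKF w hw).1]
  have h0K : (0 : ℂ) ∉ K := fun h => by
    have := hne 0 h (by simp)
    exact hx₀.ne (by exact_mod_cast this)
  obtain ⟨ε, hε, hεK⟩ := Metric.isOpen_iff.1 hKc.isClosed.isOpen_compl 0 h0K
  -- The half-disc of this radius misses `K` and its mirror image, and stays at distance at least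
  -- `x₀ / 2` from `x₀`.
  set r : ℝ := min ε (x₀ / 2) with hr
  have hr0 : 0 < r := lt_min hε (by linarith)
  have hrx : r ≤ x₀ / 2 := min_le_right _ _
  set U : Set ℂ := {z : ℂ | 0 < z.re ∧ z ∉ K ∧ (starRingEnd ℂ) z ∉ K} with hU
  have hUopen : IsOpen U := by
    refine (isOpen_lt continuous_const Complex.continuous_re).inter (IsOpen.inter ?_ ?_)
    · exact hKc.isClosed.isOpen_compl
    · exact hKc.isClosed.isOpen_compl.preimage Complex.continuous_conj
  set D : Set ℂ := {z | 0 < z.re} ∩ Metric.ball 0 r with hD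
  have hDU : D ⊆ U := by
    rintro z ⟨hz1, hz2⟩
    rw [mem_ball_zero_iff] at hz2
    have hzε : ‖z‖ < ε := hz2.trans_le (min_le_left _ _)
    exact ⟨hz1, hεK (by simpa using hzε), hεK (by simpa using hzε)⟩
  set a : ℝ := r / 2 with ha
  have haD : (a : ℂ) ∈ D := by
    refine ⟨by simpa [ha] using hr0, ?_⟩
    rw [mem_ball_zero_iff, Complex.norm_real, Real.norm_eq_abs, abs_of_pos (by positivity)]
    linarith
  set V : Set ℂ := connectedComponentIn U a with hV
  have hDV : D ⊆ V :=
    (((convex_halfSpace_re_gt 0).inter (convex_ball 0 r)).isPreconnected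
      ).subset_connectedComponentIn haD hDU
  have hVb : Bornology.IsBounded V := isBounded_connectedComponentIn_of_joinedIn hKc
    (fun z hz => (hKF z hz).2.1) hy₀ hJ (by positivity) (by linarith) (hDU haD).2.1
  obtain ⟨R, hR0, hVR⟩ := hVb.closure.exists_pos_norm_le
  have hVre : ∀ w ∈ closure V, 0 ≤ w.re := fun w hw =>
    closure_minimal (t := {w : ℂ | 0 ≤ w.re})
      (fun z hz => show (0 : ℝ) ≤ z.re from le_of_lt (connectedComponentIn_subset _ _ hz).1)
      (isClosed_le continuous_const Complex.continuous_re) hw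
  -- The two entries serve the two kinds of frontier points of `V`: those on the imaginary axis, and
  -- those on the arc or its reflection.
  set C₁ : ℝ := max ((R + x₀) ^ m) (1 / c) with hC₁
  refine ⟨r, C₁ / (x₀ / 2) ^ m, hr0, ?_⟩
  intro E _ _ h B hh hB hbI hbF z hz hzr
  -- Here `v` is `w` or its conjugate. The growth `c ‖v - x₀‖ ^ m ≤ ‖F v‖ - M` is exactly what makes
  -- `(v - x₀) ^ m • h v` bounded on the arc.
  have hbK : ∀ w ∈ K, ∀ v : ℂ, 0 ≤ v.re → ‖F v‖ = ‖F w‖ → ‖v - x₀‖ = ‖w - x₀‖ →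
      v ≠ x₀ → ‖v - x₀‖ ^ m * ‖h v‖ ≤ C₁ * B := by
    intro w hw v hv h1 h2 h3
    have hwx : w ≠ x₀ := by
      rw [← sub_ne_zero, ← norm_ne_zero_iff, ← h2, norm_ne_zero_iff, sub_ne_zero]
      exact h3
    have h4 := hbF v hv (by rw [h1]; exact (hKF w hw).2.2.2 hwx)
    have h5 := (hKF w hw).2.2.1
    rw [← h1, ← h2] at h5
    have h6 : ‖v - x₀‖ ^ m * ‖h v‖ ≤ 1 / c * B := by
      rw [one_div_mul_eq_div, le_div_iff₀ hc0]
      refine le_trans ?_ h4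
      have := norm_nonneg (h v)
      nlinarith
    exact h6.trans (mul_le_mul_of_nonneg_right (le_max_right _ _) hB)
  have hcont : Continuous fun v : ℂ => ‖v - x₀‖ ^ m * ‖h v‖ := by
    have := hh.continuous
    fun_prop
  have hfr : ∀ w ∈ frontier V, ‖(w - x₀) ^ m • h w‖ ≤ C₁ * B := by
    intro w hw
    rw [norm_smul, norm_pow]
    have hwre := hVre w hw.1
    have hwU : w ∉ U := hUopen.notMem_of_mem_frontier_connectedComponentIn hw
    rcases hwre.eq_or_lt with h0 | h0
    · have h1 : ‖w - x₀‖ ≤ R + x₀ := by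
        refine (norm_sub_le _ _).trans ?_
        rw [Complex.norm_real, Real.norm_eq_abs, abs_of_pos hx₀]
        linarith [hVR w hw.1]
      calc ‖w - x₀‖ ^ m * ‖h w‖ ≤ (R + x₀) ^ m * B := by
            gcongr
            exact hbI w h0.symm
        _ ≤ C₁ * B := mul_le_mul_of_nonneg_right (le_max_left _ _) hB
    · by_cases hwx : w = x₀
      · have hC₁B : 0 ≤ C₁ * B :=
          mul_nonneg ((by positivity : 0 ≤ 1 / c).trans (le_max_right _ _)) hB
        simpa [hwx, hm0] using hC₁B
      · by_cases hwK : w ∈ K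
        · exact hbK w hwK w hwre rfl rfl hwx
        · have hwK' : (starRingEnd ℂ) w ∈ K := by
            by_contra hcon
            exact hwU ⟨h0, hwK, hcon⟩
          refine hbK _ hwK' w hwre (by rw [hconj w hwre, Complex.norm_conj]) ?_ hwx
          rw [← Complex.norm_conj, map_sub, Complex.conj_ofReal]
  have hmain := Complex.norm_le_of_forall_mem_frontier_norm_le hVb (C := C₁ * B)
    (f := fun w : ℂ => (w - x₀) ^ m • h w) (Differentiable.diffContOnCl (by fun_prop)) hfr
    (subset_closure (hDV ⟨hz, by simpa using hzr⟩))
  rw [norm_smul, norm_pow] at hmain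
  have hdist : x₀ / 2 ≤ ‖z - x₀‖ := by
    have h1 := norm_sub_norm_le (x₀ : ℂ) z
    rw [Complex.norm_real, Real.norm_eq_abs, abs_of_pos hx₀, norm_sub_rev] at h1
    linarith
  rw [div_mul_eq_mul_div, le_div_iff₀ (by positivity)]
  refine le_trans ?_ hmain
  rw [mul_comm]
  gcongr

/-! ### Signed measures and the Laplace transform. -/

/-- The integral against a signed measure is the difference of the integrals against the positive
and negative parts. -/
theorem MeasureTheory.SignedMeasure.integral_eq_sub {Ω E : Type*} [MeasurableSpace Ω]
    [NormedAddCommGroup E] [NormedSpace ℝ E] (μ : SignedMeasure Ω) {f : Ω → E}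
    (hf : μ.Integrable f) :
    ∫ᵛ ω, f ω ∂<•μ = ∫ ω, f ω ∂μ.toJordanDecomposition.posPart -
      ∫ ω, f ω ∂μ.toJordanDecomposition.negPart := by
  have hf' : Integrable f (μ.toJordanDecomposition.posPart + μ.toJordanDecomposition.negPart) := by
    have : μ.totalVariation = μ.variation := μ.totalVariation_eq_variation
    rw [SignedMeasure.totalVariation] at this
    rwa [this]
  have hμ := μ.toSignedMeasure_toJordanDecomposition
  rw [JordanDecomposition.toSignedMeasure] at hμ
  conv_lhs => rw [← hμ]
  rw [VectorMeasure.integral_sub_vectorMeasure]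
  · simp
  · simpa [VectorMeasure.Integrable] using hf'.left_of_add_measure
  · simpa [VectorMeasure.Integrable] using hf'.right_of_add_measure

theorem MeasureTheory.SignedMeasure.integrable_posPart {Ω E : Type*} [MeasurableSpace Ω]
    [NormedAddCommGroup E] {μ : SignedMeasure Ω} {f : Ω → E} (hf : μ.Integrable f) :
    Integrable f μ.toJordanDecomposition.posPart := by
  rw [VectorMeasure.Integrable, ← μ.totalVariation_eq_variation] at hf
  exact hf.left_of_add_measure

theorem MeasureTheory.SignedMeasure.integrable_negPart {Ω E : Type*} [MeasurableSpace Ω]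
    [NormedAddCommGroup E] {μ : SignedMeasure Ω} {f : Ω → E} (hf : μ.Integrable f) :
    Integrable f μ.toJordanDecomposition.negPart := by
  rw [VectorMeasure.Integrable, ← μ.totalVariation_eq_variation] at hf
  exact hf.right_of_add_measure

instance MeasureTheory.SignedMeasure.isFiniteMeasure_variation {Ω : Type*} [MeasurableSpace Ω]
    (μ : SignedMeasure Ω) : IsFiniteMeasure μ.variation := by
  rw [← μ.totalVariation_eq_variation]
  infer_instance

theorem norm_exp_neg_mul_le_one {z : ℂ} (hz : 0 ≤ z.re) {ξ : ℝ} (hξ : 0 ≤ ξ) :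
    ‖Complex.exp (-(z * (ξ : ℂ)))‖ ≤ 1 := by
  rw [Complex.norm_exp]
  simpa using mul_nonneg hz hξ

theorem integrable_exp_neg_mul {ρ : Measure (Ioi (0 : ℝ))} [IsFiniteMeasure ρ] {z : ℂ}
    (hz : 0 ≤ z.re) :
    Integrable (fun ξ : Ioi (0 : ℝ) => Complex.exp (-(z * ((ξ : ℝ) : ℂ)))) ρ :=
  Integrable.of_bound (by fun_prop) 1
    (Filter.Eventually.of_forall fun ξ => norm_exp_neg_mul_le_one hz (le_of_lt ξ.2))

theorem laplaceTransform_eq_sub (μ : SignedMeasure (Ioi (0 : ℝ))) {z : ℂ} (hz : 0 ≤ z.re) :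
    laplaceTransform μ z =
      ∫ ξ : Ioi (0 : ℝ), Complex.exp (-(z * ((ξ : ℝ) : ℂ))) ∂μ.toJordanDecomposition.posPart -
      ∫ ξ : Ioi (0 : ℝ), Complex.exp (-(z * ((ξ : ℝ) : ℂ))) ∂μ.toJordanDecomposition.negPart :=
  μ.integral_eq_sub (integrable_exp_neg_mul hz)

theorem norm_laplaceTransform_le (μ : SignedMeasure (Ioi (0 : ℝ))) {z : ℂ} (hz : 0 ≤ z.re) :
    ‖laplaceTransform μ z‖ ≤ μ.toJordanDecomposition.posPart.real univ +
      μ.toJordanDecomposition.negPart.real univ := by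
  rw [laplaceTransform_eq_sub μ hz]
  refine (norm_sub_le _ _).trans (add_le_add ?_ ?_) <;>
  · refine (norm_integral_le_of_norm_le_const
      (Filter.Eventually.of_forall fun ξ : Ioi (0 : ℝ) =>
        norm_exp_neg_mul_le_one hz (le_of_lt ξ.2))).trans ?_
    rw [one_mul]

/-- The integral is the complex moment generating function of `-ξ`, which is analytic over the
interior of its integrability set; that set contains `[0, ∞)`. -/
theorem differentiableOn_integral_exp_neg_mul (ρ : Measure (Ioi (0 : ℝ))) [IsFiniteMeasure ρ] :
    DifferentiableOn ℂ
      (fun z : ℂ => ∫ ξ : Ioi (0 : ℝ), Complex.exp (-(z * ((ξ : ℝ) : ℂ))) ∂ρ) {z | 0 < z.re} := by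
  have h := ProbabilityTheory.differentiableOn_complexMGF (X := fun ξ : Ioi (0 : ℝ) => -(ξ : ℝ))
    (μ := ρ)
  have hsub : Ici (0 : ℝ) ⊆
      ProbabilityTheory.integrableExpSet (fun ξ : Ioi (0 : ℝ) => -(ξ : ℝ)) ρ := by
    intro t ht
    refine Integrable.of_bound (by fun_prop) 1 (Filter.Eventually.of_forall fun ξ => ?_)
    rw [Real.norm_eq_abs, Real.abs_exp, Real.exp_le_one_iff]
    have : (0 : ℝ) < ξ := ξ.2
    have := mul_nonneg ht this.le
    simpa using this
  refine (h.mono fun z hz => ?_).congr fun z _ => ?_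
  · have := interior_mono hsub
    rw [interior_Ici] at this
    exact this hz
  · simp [ProbabilityTheory.complexMGF]

theorem continuousOn_integral_exp_neg_mul (ρ : Measure (Ioi (0 : ℝ))) [IsFiniteMeasure ρ] :
    ContinuousOn
      (fun z : ℂ => ∫ ξ : Ioi (0 : ℝ), Complex.exp (-(z * ((ξ : ℝ) : ℂ))) ∂ρ) {z | 0 ≤ z.re} := by
  refine continuousOn_of_dominated (bound := fun _ => 1) (fun z _ => by fun_prop)
    (fun z hz => Filter.Eventually.of_forall fun ξ =>
      norm_exp_neg_mul_le_one hz (le_of_lt ξ.2)) (integrable_const _)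
    (Filter.Eventually.of_forall fun ξ => by fun_prop)

theorem differentiableOn_laplaceTransform (μ : SignedMeasure (Ioi (0 : ℝ))) :
    DifferentiableOn ℂ (laplaceTransform μ) {z | 0 < z.re} :=
  ((differentiableOn_integral_exp_neg_mul μ.toJordanDecomposition.posPart).sub
    (differentiableOn_integral_exp_neg_mul μ.toJordanDecomposition.negPart)).congr
    fun _ hz => laplaceTransform_eq_sub μ (le_of_lt hz)

theorem continuousOn_laplaceTransform (μ : SignedMeasure (Ioi (0 : ℝ))) :
    ContinuousOn (laplaceTransform μ) {z | 0 ≤ z.re} :=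
  ((continuousOn_integral_exp_neg_mul μ.toJordanDecomposition.posPart).sub
    (continuousOn_integral_exp_neg_mul μ.toJordanDecomposition.negPart)).congr
    fun _ hz => laplaceTransform_eq_sub μ hz

/-- This uses that `μ` is real; it makes `F` real on `[0, ∞)` and lets the arc be reflected in the
real axis. -/
theorem laplaceTransform_conj (μ : SignedMeasure (Ioi (0 : ℝ))) {z : ℂ} (hz : 0 ≤ z.re) :
    laplaceTransform μ ((starRingEnd ℂ) z) = (starRingEnd ℂ) (laplaceTransform μ z) := by
  rw [laplaceTransform_eq_sub μ hz, laplaceTransform_eq_sub μ (by simpa using hz), map_sub,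
    ← integral_conj, ← integral_conj]
  simp [← Complex.exp_conj]

theorem laplaceTransform_zero {μ : SignedMeasure (Ioi (0 : ℝ))} (hμ : μ univ = 0) :
    laplaceTransform μ 0 = 0 := by
  rw [laplaceTransform]
  simp [hμ]

theorem tendsto_integral_exp_neg_mul_atTop (ρ : Measure (Ioi (0 : ℝ))) [IsFiniteMeasure ρ] :
    Filter.Tendsto (fun x : ℝ => ∫ ξ : Ioi (0 : ℝ), Complex.exp (-((x : ℂ) * ((ξ : ℝ) : ℂ))) ∂ρ)
      Filter.atTop (nhds 0) := by
  have h : Filter.Tendsto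
      (fun x : ℝ => ∫ ξ : Ioi (0 : ℝ), Complex.exp (-((x : ℂ) * ((ξ : ℝ) : ℂ))) ∂ρ)
      Filter.atTop (nhds (∫ _ : Ioi (0 : ℝ), (0 : ℂ) ∂ρ)) := by
    refine tendsto_integral_filter_of_dominated_convergence (fun _ => 1)
      (Filter.Eventually.of_forall fun x => by fun_prop) ?_ (integrable_const _) ?_
    · filter_upwards [Filter.eventually_ge_atTop 0] with x hx
      exact Filter.Eventually.of_forall fun ξ =>
        norm_exp_neg_mul_le_one (by simpa using hx) (le_of_lt ξ.2)
    · refine Filter.Eventually.of_forall fun ξ => ?_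
      rw [tendsto_zero_iff_norm_tendsto_zero]
      have hξ : (0 : ℝ) < ξ := ξ.2
      have : Filter.Tendsto (fun x : ℝ => Real.exp (-(x * ξ))) Filter.atTop (nhds 0) :=
        Real.tendsto_exp_neg_atTop_nhds_zero.comp (Filter.tendsto_id.atTop_mul_const hξ)
      refine this.congr fun x => ?_
      rw [Complex.norm_exp]
      simp
  simpa using h

theorem tendsto_laplaceTransform_atTop (μ : SignedMeasure (Ioi (0 : ℝ))) :
    Filter.Tendsto (fun x : ℝ => laplaceTransform μ x) Filter.atTop (nhds 0) := by
  have h := (tendsto_integral_exp_neg_mul_atTop μ.toJordanDecomposition.posPart).sub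
    (tendsto_integral_exp_neg_mul_atTop μ.toJordanDecomposition.negPart)
  rw [sub_zero] at h
  refine h.congr' ?_
  filter_upwards [Filter.eventually_ge_atTop 0] with x hx
  exact (laplaceTransform_eq_sub μ (by simpa using hx)).symm

/-- A signed measure is determined by its Laplace transform on the imaginary axis. -/
theorem eq_zero_of_laplaceTransform_imaginary_eq_zero {μ : SignedMeasure (Ioi (0 : ℝ))}
    (h : ∀ y : ℝ, laplaceTransform μ (y * Complex.I) = 0) : μ = 0 := by
  have hval : MeasurableEmbedding (Subtype.val : Ioi (0 : ℝ) → ℝ) :=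
    MeasurableEmbedding.subtype_coe measurableSet_Ioi
  have hchar : ∀ (ρ : Measure (Ioi (0 : ℝ))) (t : ℝ), charFun (ρ.map Subtype.val) t =
      ∫ ξ : Ioi (0 : ℝ), Complex.exp (-((((-t : ℝ) : ℂ) * Complex.I) * ((ξ : ℝ) : ℂ))) ∂ρ := by
    intro ρ t
    rw [charFun_apply_real, hval.integral_map]
    congr 1
    ext ξ
    congr 1
    push_cast
    ring
  -- On the imaginary axis the transform is the difference of the characteristic functions of the
  -- two Jordan parts, which determine finite measures.
  have hmap : μ.toJordanDecomposition.posPart.map Subtype.val =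
      μ.toJordanDecomposition.negPart.map (Subtype.val : Ioi (0 : ℝ) → ℝ) := by
    refine Measure.ext_of_charFun ?_
    ext t
    rw [hchar, hchar, ← sub_eq_zero, ← laplaceTransform_eq_sub μ (by simp)]
    exact h (-t)
  have heq : μ.toJordanDecomposition.posPart = μ.toJordanDecomposition.negPart := by
    rw [← hval.comap_map μ.toJordanDecomposition.posPart, hmap, hval.comap_map]
  have hμ := μ.toSignedMeasure_toJordanDecomposition
  rw [JordanDecomposition.toSignedMeasure] at hμ
  rw [← hμ, ← sub_self μ.toJordanDecomposition.negPart.toSignedMeasure]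
  congr 1
  simp only [heq]

theorem isPreconnected_re_pos : IsPreconnected {z : ℂ | 0 < z.re} :=
  (convex_halfSpace_re_gt 0).isPreconnected

/-- If the Laplace transform of `μ` is constant near a point of the open right half-plane, then
`μ = 0`. -/
theorem eq_zero_of_laplaceTransform_eventually_const {μ : SignedMeasure (Ioi (0 : ℝ))} {z₀ c : ℂ}
    (hz₀ : 0 < z₀.re) (h : ∀ᶠ z in nhds z₀, laplaceTransform μ z = c) : μ = 0 := by
  have hopen : IsOpen {z : ℂ | 0 < z.re} := isOpen_lt continuous_const Complex.continuous_re
  have heq : EqOn (laplaceTransform μ) (fun _ => c) {z | 0 < z.re} :=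
    ((differentiableOn_laplaceTransform μ).analyticOnNhd hopen).eqOn_of_preconnected_of_eventuallyEq
      analyticOnNhd_const isPreconnected_re_pos hz₀ h
  have hc : c = 0 := by
    refine tendsto_nhds_unique ?_ (tendsto_laplaceTransform_atTop μ)
    refine tendsto_const_nhds.congr' ?_
    filter_upwards [Filter.eventually_gt_atTop 0] with x hx
    exact (heq (show 0 < (x : ℂ).re by simpa using hx)).symm
  refine eq_zero_of_laplaceTransform_imaginary_eq_zero fun y => ?_
  have hcl : EqOn (laplaceTransform μ) (fun _ => c) {z | 0 ≤ z.re} := by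
    refine heq.of_subset_closure (continuousOn_laplaceTransform μ) continuousOn_const
      (fun z hz => show (0 : ℝ) ≤ z.re from le_of_lt hz) ?_
    rw [Complex.closure_setOfPred_lt_re]
  rw [hcl (show 0 ≤ (y * Complex.I).re by simp), hc]

/-- The maximum of `|F|` on `[0, ∞)` is positive and attained at a point of `(0, ∞)`. -/
theorem exists_isGreatest_norm_laplaceTransform {μ : SignedMeasure (Ioi (0 : ℝ))} (hμ : μ ≠ 0)
    (hμ_total : μ univ = 0) :
    ∃ x₀ : ℝ, 0 < x₀ ∧ 0 < ‖laplaceTransform μ x₀‖ ∧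
      ∀ x : ℝ, 0 ≤ x → ‖laplaceTransform μ x‖ ≤ ‖laplaceTransform μ x₀‖ := by
  obtain ⟨x₁, hx₁, hFx₁⟩ : ∃ x₁ : ℝ, 0 < x₁ ∧ laplaceTransform μ x₁ ≠ 0 := by
    by_contra! hcon
    refine hμ ?_
    have hopen : IsOpen {z : ℂ | 0 < z.re} := isOpen_lt continuous_const Complex.continuous_re
    refine eq_zero_of_laplaceTransform_eventually_const (z₀ := 1) (c := 0) (by simp) ?_
    have hana := (differentiableOn_laplaceTransform μ).analyticAt
      (hopen.mem_nhds (show 0 < (1 : ℂ).re by simp))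
    -- Zeros at all real points near `1` cannot be isolated.
    refine (hana.eventually_eq_zero_or_eventually_ne_zero).resolve_right fun hne => ?_
    have hlim : Filter.Tendsto (fun x : ℝ => (x : ℂ)) (nhdsWithin 1 (Ioi 1))
        (nhdsWithin 1 {1}ᶜ) := by
      refine tendsto_nhdsWithin_iff.2 ⟨?_, ?_⟩
      · exact (Complex.continuous_ofReal.tendsto' 1 1 (by simp)).mono_left nhdsWithin_le_nhds
      · filter_upwards [self_mem_nhdsWithin] with x hx
        have : x ≠ 1 := ne_of_gt hx
        simpa using this
    obtain ⟨x, hx1, hx2⟩ := ((hlim.eventually hne).and self_mem_nhdsWithin).exists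
    exact hx1 (hcon x (zero_lt_one.trans hx2))
  have hcont : ContinuousOn (fun x : ℝ => ‖laplaceTransform μ x‖) (Ici 0) :=
    ((continuousOn_laplaceTransform μ).comp Complex.continuous_ofReal.continuousOn
      fun x hx => by simpa using hx).norm
  obtain ⟨x₀, hx₀, hmax⟩ := hcont.exists_isMaxOn' isClosed_Ici (x₀ := x₁) hx₁.le (by
    rw [Filter.eventually_inf_principal, cocompact_eq_atBot_atTop, Filter.eventually_sup]
    refine ⟨?_, ?_⟩
    · filter_upwards [Filter.eventually_lt_atBot 0] with x hx hx'
      exact absurd hx' (not_le.2 hx)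
    · have h := (tendsto_laplaceTransform_atTop μ).norm
      rw [norm_zero] at h
      filter_upwards [h.eventually (gt_mem_nhds (norm_pos_iff.2 hFx₁))] with x hx _
      exact hx.le)
  have hpos : 0 < ‖laplaceTransform μ x₀‖ := (norm_pos_iff.2 hFx₁).trans_le (hmax hx₁.le)
  refine ⟨x₀, lt_of_le_of_ne hx₀ ?_, hpos, fun x hx => hmax hx⟩
  rintro rfl
  simp [laplaceTransform_zero hμ_total] at hpos

/-! ### Exponential transforms of rapidly decaying functions. -/

section ExponentialIntegral

variable {X : Type*} [NormedAddCommGroup X] [NormedSpace ℂ X]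

theorem integrableOn_exp_smul_of_decay {f : ℝ → X} (hf : ContinuousOn f (Ici 0))
    (hdecay : ∀ ω : ℝ, ∃ C : ℝ, ∀ t : ℝ, 0 ≤ t → ‖f t‖ ≤ C * Real.exp (-ω * t)) (z : ℂ) :
    IntegrableOn (fun t : ℝ => Complex.exp (z * t) • f t) (Ioi 0) := by
  obtain ⟨C, hC⟩ := hdecay (z.re + 1)
  have hmeas : AEStronglyMeasurable (fun t : ℝ => Complex.exp (z * t) • f t)
      (volume.restrict (Ioi 0)) :=
    ((by fun_prop : Continuous fun t : ℝ => Complex.exp (z * t)).continuousOn.smul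
      (hf.mono Ioi_subset_Ici_self)).aestronglyMeasurable measurableSet_Ioi
  refine ((exp_neg_integrableOn_Ioi 0 one_pos).const_mul C).mono' hmeas ?_
  filter_upwards [ae_restrict_mem measurableSet_Ioi] with t ht
  have h := hC t (le_of_lt ht)
  rw [norm_smul, Complex.norm_exp]
  have hre : (z * (t : ℂ)).re = z.re * t := by simp
  rw [hre]
  calc Real.exp (z.re * t) * ‖f t‖
      ≤ Real.exp (z.re * t) * (C * Real.exp (-(z.re + 1) * t)) := by gcongr
    _ = C * Real.exp (-1 * t) := by
        rw [mul_left_comm, ← Real.exp_add]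
        congr 2
        ring

theorem integrableOn_of_decay {f : ℝ → X} (hf : ContinuousOn f (Ici 0))
    (hdecay : ∀ ω : ℝ, ∃ C : ℝ, ∀ t : ℝ, 0 ≤ t → ‖f t‖ ≤ C * Real.exp (-ω * t)) :
    IntegrableOn f (Ioi 0) := by
  simpa using integrableOn_exp_smul_of_decay hf hdecay 0

/-- The exponential transform of a function with superexponential decay is entire. -/
theorem differentiable_integral_exp_smul {f : ℝ → X} (hf : ContinuousOn f (Ici 0))
    (hdecay : ∀ ω : ℝ, ∃ C : ℝ, ∀ t : ℝ, 0 ≤ t → ‖f t‖ ≤ C * Real.exp (-ω * t)) :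
    Differentiable ℂ (fun z : ℂ => ∫ t in Ioi (0 : ℝ), Complex.exp (z * t) • f t) := by
  intro z₀
  obtain ⟨C, hC⟩ := hdecay (z₀.re + 3)
  have hC0 : 0 ≤ C := by simpa using (norm_nonneg _).trans (hC 0 le_rfl)
  have hmeas : ∀ z : ℂ, AEStronglyMeasurable (fun t : ℝ => Complex.exp (z * t) • f t)
      (volume.restrict (Ioi 0)) := fun z =>
    (integrableOn_exp_smul_of_decay hf hdecay z).aestronglyMeasurable
  refine (hasDerivAt_integral_of_dominated_loc_of_deriv_le
    (F' := fun z (t : ℝ) => (Complex.exp (z * t) * t) • f t)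
    (bound := fun t => C * Real.exp (-1 * t)) (Metric.ball_mem_nhds z₀ one_pos)
    (Filter.Eventually.of_forall hmeas) (integrableOn_exp_smul_of_decay hf hdecay z₀) ?_ ?_
    ((exp_neg_integrableOn_Ioi 0 one_pos).const_mul C) ?_).2.differentiableAt
  · exact ((by fun_prop : Continuous fun t : ℝ =>
      Complex.exp (z₀ * t) * t).continuousOn.smul
      (hf.mono Ioi_subset_Ici_self)).aestronglyMeasurable measurableSet_Ioi
  · filter_upwards [ae_restrict_mem measurableSet_Ioi] with t ht z hz
    have ht0 : (0 : ℝ) < t := ht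
    have h := hC t ht0.le
    have hzre : z.re ≤ z₀.re + 1 := by
      have h1 := (Complex.abs_re_le_norm (z - z₀)).trans (mem_ball_iff_norm.1 hz).le
      have h2 := (abs_le.1 h1).2
      rw [Complex.sub_re] at h2
      linarith
    rw [norm_smul, norm_mul, Complex.norm_exp, Complex.norm_real, Real.norm_eq_abs,
      abs_of_pos ht0]
    have hre : (z * (t : ℂ)).re = z.re * t := by simp
    rw [hre]
    have ht1 : t ≤ Real.exp t := by linarith [Real.add_one_le_exp t]
    calc Real.exp (z.re * t) * t * ‖f t‖
        ≤ Real.exp ((z₀.re + 1) * t) * Real.exp t * (C * Real.exp (-(z₀.re + 3) * t)) := by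
          gcongr
      _ = C * Real.exp (-1 * t) := by
          rw [mul_left_comm, ← Real.exp_add, ← Real.exp_add]
          congr 2
          ring
  · refine Filter.Eventually.of_forall fun t z _ => ?_
    have h1 : HasDerivAt (fun z : ℂ => z * (t : ℂ)) (t : ℂ) z := by
      simpa using (hasDerivAt_id z).mul_const (t : ℂ)
    exact h1.cexp.smul_const (f t)

theorem norm_integral_exp_smul_le {f : ℝ → X} (hf : IntegrableOn f (Ioi 0)) {z : ℂ}
    (hz : z.re ≤ 0) :
    ‖∫ t in Ioi (0 : ℝ), Complex.exp (z * t) • f t‖ ≤ ∫ t in Ioi (0 : ℝ), ‖f t‖ := by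
  refine norm_integral_le_of_norm_le hf.norm ?_
  filter_upwards [ae_restrict_mem measurableSet_Ioi] with t ht
  rw [norm_smul, Complex.norm_exp]
  refine mul_le_of_le_one_left (norm_nonneg _) (Real.exp_le_one_iff.2 ?_)
  simpa using mul_nonpos_of_nonpos_of_nonneg hz (le_of_lt ht)

theorem tendsto_integral_exp_neg_smul {f : ℝ → X} (hf : IntegrableOn f (Ioi 0)) :
    Filter.Tendsto (fun n : ℝ => ∫ t in Ioi (0 : ℝ), Complex.exp ((-n : ℂ) * t) • f t)
      Filter.atTop (nhds 0) := by
  have h : Filter.Tendsto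
      (fun n : ℝ => ∫ t in Ioi (0 : ℝ), Complex.exp ((-n : ℂ) * t) • f t)
      Filter.atTop (nhds (∫ _ in Ioi (0 : ℝ), (0 : X))) := by
    refine tendsto_integral_filter_of_dominated_convergence (fun t => ‖f t‖)
      (Filter.Eventually.of_forall fun n => ?_) ?_ hf.norm ?_
    · exact (by fun_prop : Continuous fun t : ℝ =>
        Complex.exp ((-n : ℂ) * t)).aestronglyMeasurable.smul hf.aestronglyMeasurable
    · filter_upwards [Filter.eventually_ge_atTop 0] with n hn
      filter_upwards [ae_restrict_mem measurableSet_Ioi] with t ht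
      rw [norm_smul, Complex.norm_exp]
      refine mul_le_of_le_one_left (norm_nonneg _) (Real.exp_le_one_iff.2 ?_)
      simpa using mul_nonneg hn (le_of_lt ht)
    · filter_upwards [ae_restrict_mem measurableSet_Ioi] with t ht
      rw [tendsto_zero_iff_norm_tendsto_zero]
      have h1 : Filter.Tendsto (fun n : ℝ => Real.exp (-(n * t)) * ‖f t‖) Filter.atTop
          (nhds (0 * ‖f t‖)) :=
        (Real.tendsto_exp_neg_atTop_nhds_zero.comp
          (Filter.tendsto_id.atTop_mul_const (show (0 : ℝ) < t from ht))).mul_const _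
      rw [zero_mul] at h1
      refine h1.congr fun n => ?_
      rw [norm_smul, Complex.norm_exp]
      simp
  simpa using h

theorem integral_exp_smul_shift {f : ℝ → X} (z : ℂ) (a : ℝ) :
    Complex.exp (z * a) • ∫ t in Ioi (0 : ℝ), Complex.exp (z * t) • f (t + a) =
      ∫ t in Ioi a, Complex.exp (z * t) • f t := by
  have hpre : (fun t : ℝ => t + a) ⁻¹' Ioi a = Ioi 0 := by
    ext t
    simp
  have h := (measurePreserving_add_right volume a).setIntegral_preimage_emb
    (measurableEmbedding_addRight a) (fun t : ℝ => Complex.exp (z * t) • f t) (Ioi a)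
  rw [hpre] at h
  rw [← h, ← integral_smul]
  congr 1
  ext t
  rw [smul_smul, ← Complex.exp_add]
  congr 2
  push_cast
  ring

/-- Shifting the orbit by `a` and multiplying by `e^{za}` loses only the part of the integral over
`(0, a]`. -/
theorem integral_exp_smul_sub_shift {f : ℝ → X} (hf : ContinuousOn f (Ici 0))
    (hdecay : ∀ ω : ℝ, ∃ C : ℝ, ∀ t : ℝ, 0 ≤ t → ‖f t‖ ≤ C * Real.exp (-ω * t)) (z : ℂ)
    {a : ℝ} (ha : 0 ≤ a) :
    (∫ t in Ioi (0 : ℝ), Complex.exp (z * t) • f t) -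
        Complex.exp (z * a) • ∫ t in Ioi (0 : ℝ), Complex.exp (z * t) • f (t + a) =
      ∫ t in Ioc 0 a, Complex.exp (z * t) • f t := by
  have hint := integrableOn_exp_smul_of_decay hf hdecay z
  rw [integral_exp_smul_shift, sub_eq_iff_eq_add, ← setIntegral_union (Ioc_disjoint_Ioi le_rfl)
    measurableSet_Ioi (hint.mono_set Ioc_subset_Ioi_self) (hint.mono_set (Ioi_subset_Ioi ha)),
    Ioc_union_Ioi_eq_Ioi ha]

/-- After division by `e^{za}` the lost part has kernel `e^{z(t - a)}` with `t ≤ a`, of modulus at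
most `1`. The resulting bound depends on neither `z` nor `a`. -/
theorem norm_exp_neg_smul_integral_sub_shift_le {f : ℝ → X} (hf : ContinuousOn f (Ici 0))
    (hdecay : ∀ ω : ℝ, ∃ C : ℝ, ∀ t : ℝ, 0 ≤ t → ‖f t‖ ≤ C * Real.exp (-ω * t)) {z : ℂ}
    (hz : 0 ≤ z.re) {a : ℝ} (ha : 0 ≤ a) :
    ‖Complex.exp (-(z * a)) • (∫ t in Ioi (0 : ℝ), Complex.exp (z * t) • f t) -
        ∫ t in Ioi (0 : ℝ), Complex.exp (z * t) • f (t + a)‖ ≤ ∫ t in Ioi (0 : ℝ), ‖f t‖ := by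
  have hint := integrableOn_of_decay hf hdecay
  have h := congrArg (fun v => Complex.exp (-(z * a)) • v)
    (integral_exp_smul_sub_shift hf hdecay z ha)
  simp only [smul_sub, smul_smul, ← Complex.exp_add, neg_add_cancel, Complex.exp_zero,
    one_smul] at h
  rw [h, ← integral_smul]
  have hle : ∫ t in Ioc 0 a, ‖f t‖ ≤ ∫ t in Ioi (0 : ℝ), ‖f t‖ :=
    setIntegral_mono_set hint.norm (Filter.Eventually.of_forall fun _ => norm_nonneg _)
      Ioc_subset_Ioi_self.eventuallyLE
  refine le_trans ?_ hle
  refine norm_integral_le_of_norm_le (IntegrableOn.mono_set hint Ioc_subset_Ioi_self).norm ?_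
  filter_upwards [ae_restrict_mem measurableSet_Ioc] with t ht
  rw [smul_smul, ← Complex.exp_add, norm_smul, Complex.norm_exp]
  refine mul_le_of_le_one_left (norm_nonneg _) (Real.exp_le_one_iff.2 ?_)
  have h1 : (-(z * (a : ℂ)) + z * t).re = z.re * (t - a) := by
    simp
    ring
  rw [h1]
  exact mul_nonpos_of_nonneg_of_nonpos hz (by linarith [ht.2])

/-- A semigroup orbit with superexponential decay whose exponential transform is bounded vanishes. -/
theorem eq_zero_of_integral_exp_smul_bounded [CompleteSpace X] {f : ℝ → X}
    (hf : ContinuousOn f (Ici 0))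
    (hdecay : ∀ ω : ℝ, ∃ C : ℝ, ∀ t : ℝ, 0 ≤ t → ‖f t‖ ≤ C * Real.exp (-ω * t))
    {S : ℝ → X →L[ℂ] X} (hS : ∀ a t : ℝ, 0 < a → 0 ≤ t → f (t + a) = S a (f t)) {C : ℝ}
    (hC : ∀ z : ℂ, ‖∫ t in Ioi (0 : ℝ), Complex.exp (z * t) • f t‖ ≤ C) {a : ℝ} (ha : 0 < a) :
    f a = 0 := by
  have hint := integrableOn_of_decay hf hdecay
  have hzero : ∀ z : ℂ, ∫ t in Ioi (0 : ℝ), Complex.exp (z * t) • f t = 0 := by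
    intro z
    have hb : Bornology.IsBounded
        (range fun z : ℂ => ∫ t in Ioi (0 : ℝ), Complex.exp (z * t) • f t) :=
      isBounded_iff_forall_norm_le.2 ⟨C, by
        rintro _ ⟨w, rfl⟩
        exact hC w⟩
    -- Liouville's theorem; the constant is then the limit at `-∞`, namely `0`.
    have hconst : ∀ n : ℝ, ∫ t in Ioi (0 : ℝ), Complex.exp ((-n : ℂ) * t) • f t =
        ∫ t in Ioi (0 : ℝ), Complex.exp (z * t) • f t := fun n =>
      (differentiable_integral_exp_smul hf hdecay).apply_eq_apply_of_bounded hb _ _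
    refine tendsto_nhds_unique ?_ (tendsto_integral_exp_neg_smul hint)
    simp only [hconst]
    exact tendsto_const_nhds
  have hf0 : ∫ t in Ioi (0 : ℝ), f t = 0 := by simpa using hzero 0
  -- Applying `S b` to the vanishing total integral kills the integral over `(b, ∞)` as well, so the
  -- primitive of `f` is zero and differentiation gives `f a = 0`.
  have hprim : ∀ b : ℝ, 0 < b → ∫ t in (0 : ℝ)..b, f t = 0 := by
    intro b hb
    have hshift : ∫ t in Ioi (0 : ℝ), f (t + b) = 0 := by
      rw [setIntegral_congr_fun measurableSet_Ioi (g := fun t => S b (f t))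
        fun t ht => hS b t hb (le_of_lt ht), (S b).integral_comp_comm hint, hf0, map_zero]
    have h := integral_exp_smul_sub_shift hf hdecay 0 hb.le
    simp only [zero_mul, Complex.exp_zero, one_smul, hf0, hshift, sub_zero] at h
    rw [intervalIntegral.integral_of_le hb.le, ← h]
  have hat : ContinuousAt f a := hf.continuousAt (Ici_mem_nhds ha)
  have hmeas : StronglyMeasurableAtFilter f (nhds a) :=
    ⟨Ioi 0, Ioi_mem_nhds ha, hint.aestronglyMeasurable⟩
  have hderiv := intervalIntegral.integral_hasDerivAt_right (a := 0)
    ((intervalIntegrable_iff_integrableOn_Ioc_of_le ha.le).2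
      (IntegrableOn.mono_set hint Ioc_subset_Ioi_self)) hmeas hat
  refine hderiv.unique ((hasDerivAt_const a (0 : X)).congr_of_eventuallyEq ?_)
  filter_upwards [lt_mem_nhds ha] with b hb
  exact hprim b hb

end ExponentialIntegral

/-! ### Operators given by pointwise integrals. -/

/-- A family of bounded operators that is integrable when applied to any vector integrates to a
bounded operator. -/
theorem exists_clm_eq_integral {Ω X : Type*} [MeasurableSpace Ω] [NormedAddCommGroup X]
    [NormedSpace ℂ X] [CompleteSpace X] (ρ : Measure Ω) (A : Ω → X →L[ℂ] X)
    (hA : ∀ x, Integrable (fun ω => A ω x) ρ) :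
    ∃ B : X →L[ℂ] X, ∀ x, B x = ∫ ω, A ω x ∂ρ := by
  let Φ : X →ₗ[ℂ] (Ω →₁[ρ] X) :=
    { toFun := fun x => (hA x).toL1 _
      map_add' := fun x y => by
        rw [← Integrable.toL1_add]
        congr 1
        ext ω
        simp
      map_smul' := fun c x => by
        rw [RingHom.id_apply, ← Integrable.toL1_smul]
        congr 1
        ext ω
        simp }
  have hΦ : Continuous Φ := by
    -- Closed graph theorem: an `L¹`-convergent sequence has an almost everywhere convergent
    -- subsequence, whose limit is `A ω x` because each `A ω` is continuous.
    refine Φ.continuous_of_seq_closed_graph fun u x y hu hy => ?_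
    obtain ⟨ns, hns, hae⟩ := (tendstoInMeasure_of_tendsto_Lp hy).exists_seq_tendsto_ae
    have hcoe : ∀ x, (Φ x : Ω → X) =ᵐ[ρ] fun ω => A ω x := fun x => (hA x).coeFn_toL1
    refine Lp.ext ?_
    have hall : ∀ᵐ ω ∂ρ, ∀ n, (Φ (u n) : Ω → X) ω = A ω (u n) :=
      ae_all_iff.2 fun n => hcoe (u n)
    filter_upwards [hae, hall, hcoe x] with ω h1 h2 h3
    rw [h3]
    refine tendsto_nhds_unique h1 ?_
    have h4 : Filter.Tendsto (fun k => A ω (u (ns k))) Filter.atTop (nhds (A ω x)) :=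
      ((A ω).continuous.tendsto x).comp (hu.comp hns.tendsto_atTop)
    exact h4.congr fun k => (h2 (ns k)).symm
  let Ψ : X →ₗ[ℂ] X :=
    { toFun := fun x => ∫ ω, A ω x ∂ρ
      map_add' := fun x y => by
        simp only [map_add]
        exact integral_add (hA x) (hA y)
      map_smul' := fun c x => by
        simp only [map_smul, RingHom.id_apply]
        exact integral_smul c _ }
  have hΨ : Continuous Ψ :=
    (continuous_integral.comp hΦ).congr fun x => integral_congr_ae (hA x).coeFn_toL1
  exact ⟨⟨Ψ, hΨ⟩, fun x => rfl⟩

/-! ### Decay of quasinilpotent semigroups and the action of `F(-sA)`. -/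

section Semigroup

variable {X : Type*} [NormedAddCommGroup X] [NormedSpace ℂ X]

theorem IsStronglyContinuousSemigroup.nat_mul_add {T : ℝ → X →L[ℂ] X}
    (hT : IsStronglyContinuousSemigroup T) {δ t : ℝ} (hδ : 0 < δ) (ht : 0 < t) (n : ℕ) :
    T (n * δ + t) = T δ ^ n * T t := by
  induction n with
  | zero => simp
  | succ n ih =>
    have h : ((n + 1 : ℕ) : ℝ) * δ + t = δ + (n * δ + t) := by
      push_cast
      ring
    rw [h, hT.map_add δ _ hδ (by positivity), ih, pow_succ', mul_assoc]

theorem IsStronglyContinuousSemigroup.exists_norm_le_Icc [CompleteSpace X] {T : ℝ → X →L[ℂ] X}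
    (hT : IsStronglyContinuousSemigroup T) {a b : ℝ} (ha : 0 < a) :
    ∃ K : ℝ, ∀ t ∈ Icc a b, ‖T t‖ ≤ K := by
  obtain ⟨K, hK⟩ := banach_steinhaus (g := fun t : Icc a b => T t) fun x => by
    obtain ⟨C, hC⟩ := isCompact_Icc.exists_bound_of_continuousOn
      ((hT.continuousOn x).mono fun t (ht : t ∈ Icc a b) => ha.trans_le ht.1)
    exact ⟨C, fun t => hC t t.2⟩
  exact ⟨K, fun t ht => hK ⟨t, ht⟩⟩

theorem exists_norm_pow_le_of_spectralRadius_eq_zero {A : Type*} [NormedRing A] [NormedAlgebra ℂ A]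
    [CompleteSpace A] {a : A} (ha : spectralRadius ℂ a = 0) {q : ℝ} (hq : 0 < q) :
    ∃ C : ℝ, 0 ≤ C ∧ ∀ n : ℕ, ‖a ^ n‖ ≤ C * q ^ n := by
  have h := spectrum.pow_nnnorm_pow_one_div_tendsto_nhds_spectralRadius a
  rw [ha] at h
  have hq' : (0 : ENNReal) < ENNReal.ofReal q := ENNReal.ofReal_pos.2 hq
  obtain ⟨N, hN⟩ := Filter.eventually_atTop.1 (h.eventually (gt_mem_nhds hq'))
  -- Gelfand's formula gives `‖a ^ n‖ ≤ q ^ n` beyond `N`; the sum absorbs the finitely many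
  -- remaining powers.
  refine ⟨1 + ∑ n ∈ Finset.range (N + 1), ‖a ^ n‖ / q ^ n, by positivity, fun n => ?_⟩
  rcases le_or_gt n N with hn | hn
  · have h1 : ‖a ^ n‖ / q ^ n ≤ ∑ n ∈ Finset.range (N + 1), ‖a ^ n‖ / q ^ n :=
      Finset.single_le_sum (f := fun n => ‖a ^ n‖ / q ^ n) (fun _ _ => by positivity)
        (Finset.mem_range.2 (by omega))
    rw [← div_le_iff₀ (by positivity)]
    linarith
  · have hn0 : (n : ℝ) ≠ 0 := by
      have : n ≠ 0 := by omega
      exact_mod_cast this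
    have h1 := ENNReal.rpow_le_rpow (hN n hn.le).le (Nat.cast_nonneg (α := ℝ) n)
    rw [← ENNReal.rpow_mul, one_div, inv_mul_cancel₀ hn0, ENNReal.rpow_one, ENNReal.rpow_natCast,
      ← ENNReal.ofReal_pow hq.le, ← enorm_eq_nnnorm, ← ofReal_norm,
      ENNReal.ofReal_le_ofReal_iff (by positivity)] at h1
    have h2 : 0 ≤ ∑ n ∈ Finset.range (N + 1), ‖a ^ n‖ / q ^ n := by positivity
    have := pow_pos hq n
    nlinarith

/-- A strongly continuous quasinilpotent semigroup decays faster than every exponential. -/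
theorem IsStronglyContinuousSemigroup.exists_norm_le_exp [CompleteSpace X] {T : ℝ → X →L[ℂ] X}
    (hT : IsStronglyContinuousSemigroup T) (hq : IsQuasinilpotentSemigroup T) {δ : ℝ} (hδ : 0 < δ)
    (ω : ℝ) : ∃ C : ℝ, 0 ≤ C ∧ ∀ t : ℝ, δ ≤ t → ‖T t‖ ≤ C * Real.exp (-ω * t) := by
  obtain ⟨K, hK⟩ := hT.exists_norm_le_Icc (b := 2 * δ) hδ
  have hK0 : 0 ≤ K := (norm_nonneg _).trans (hK δ ⟨le_rfl, by linarith⟩)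
  obtain ⟨C, hC0, hC⟩ := exists_norm_pow_le_of_spectralRadius_eq_zero (hq δ hδ)
    (Real.exp_pos (-ω * δ))
  refine ⟨C * K * Real.exp (|ω| * (2 * δ)), by positivity, fun t ht => ?_⟩
  -- Subtracting `δ` first leaves a remainder `t'` in `[δ, 2δ]`, away from `0`, where `T` need not
  -- be bounded.
  set n : ℕ := ⌊(t - δ) / δ⌋₊ with hn
  have hn1 : (n : ℝ) * δ ≤ t - δ := by
    rw [← le_div_iff₀ hδ]
    exact Nat.floor_le (div_nonneg (by linarith) hδ.le)
  have hn2 : t - δ < (n + 1) * δ := by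
    rw [← div_lt_iff₀ hδ]
    exact Nat.lt_floor_add_one _
  set t' : ℝ := t - n * δ with ht'
  have htt' : t = n * δ + t' := by ring
  have ht'1 : δ ≤ t' := by linarith
  have ht'2 : t' ≤ 2 * δ := by linarith
  rw [htt', hT.nat_mul_add hδ (hδ.trans_le ht'1)]
  have hexp : Real.exp (-ω * δ) ^ n ≤
      Real.exp (|ω| * (2 * δ)) * Real.exp (-ω * (n * δ + t')) := by
    rw [← Real.exp_nat_mul, ← Real.exp_add, Real.exp_le_exp]
    have h1 : ω * t' ≤ |ω| * (2 * δ) :=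
      mul_le_mul (le_abs_self ω) ht'2 (by linarith) (abs_nonneg ω)
    linarith
  calc ‖T δ ^ n * T t'‖ ≤ ‖T δ ^ n‖ * ‖T t'‖ := norm_mul_le _ _
    _ ≤ (C * Real.exp (-ω * δ) ^ n) * K :=
        mul_le_mul (hC n) (hK t' ⟨ht'1, ht'2⟩) (norm_nonneg _) (by positivity)
    _ ≤ (C * (Real.exp (|ω| * (2 * δ)) * Real.exp (-ω * (n * δ + t')))) * K := by gcongr
    _ = C * K * Real.exp (|ω| * (2 * δ)) * Real.exp (-ω * (n * δ + t')) := by ring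

theorem IsStronglyContinuousSemigroup.exists_norm_le [CompleteSpace X] {T : ℝ → X →L[ℂ] X}
    (hT : IsStronglyContinuousSemigroup T) (hq : IsQuasinilpotentSemigroup T) {δ : ℝ}
    (hδ : 0 < δ) : ∃ C : ℝ, 0 ≤ C ∧ ∀ t : ℝ, δ ≤ t → ‖T t‖ ≤ C := by
  simpa using hT.exists_norm_le_exp hq hδ 0

theorem IsStronglyContinuousSemigroup.aestronglyMeasurable_orbit {T : ℝ → X →L[ℂ] X}
    (hT : IsStronglyContinuousSemigroup T) {s : ℝ} (hs : 0 < s) (x : X)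
    (ρ : Measure (Ioi (0 : ℝ))) :
    AEStronglyMeasurable (fun ξ : Ioi (0 : ℝ) => T (s * (ξ : ℝ)) x) ρ := by
  have h : Continuous (fun ξ : Ioi (0 : ℝ) => T (s * (ξ : ℝ)) x) :=
    (hT.continuousOn x).comp_continuous (by fun_prop) fun ξ => mul_pos hs ξ.2
  exact h.aestronglyMeasurable

theorem isFunctionalCalculusDefined_of_variation_eq_zero [CompleteSpace X]
    {μ : SignedMeasure (Ioi (0 : ℝ))} {T : ℝ → X →L[ℂ] X} (hT : IsStronglyContinuousSemigroup T)
    (hq : IsQuasinilpotentSemigroup T) {a : ℝ} (ha : 0 < a)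
    (hμ : μ.variation {ξ : Ioi (0 : ℝ) | (ξ : ℝ) < a} = 0) {s : ℝ} (hs : 0 < s) :
    IsFunctionalCalculusDefined μ T s := by
  intro x
  obtain ⟨C, hC0, hC⟩ := hT.exists_norm_le hq (mul_pos hs ha)
  refine Integrable.of_bound (hT.aestronglyMeasurable_orbit hs x _) (C * ‖x‖) ?_
  have hae : ∀ᵐ ξ : Ioi (0 : ℝ) ∂μ.variation, ¬ (ξ : ℝ) < a := by
    rw [ae_iff]
    simpa using hμ
  filter_upwards [hae] with ξ hξ
  exact (T _).le_of_opNorm_le (hC _ (mul_le_mul_of_nonneg_left (not_lt.1 hξ) hs.le)) x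

theorem isFunctionalCalculusDefined_of_bounded_near_zero [CompleteSpace X]
    {μ : SignedMeasure (Ioi (0 : ℝ))} {T : ℝ → X →L[ℂ] X} (hT : IsStronglyContinuousSemigroup T)
    (hq : IsQuasinilpotentSemigroup T) {a C : ℝ} (ha : 0 < a)
    (hC : ∀ t : ℝ, 0 < t → t < a → ‖T t‖ ≤ C) {s : ℝ} (hs : 0 < s) :
    IsFunctionalCalculusDefined μ T s := by
  intro x
  obtain ⟨C', -, hC'⟩ := hT.exists_norm_le hq ha
  refine Integrable.of_bound (hT.aestronglyMeasurable_orbit hs x _) (max C C' * ‖x‖)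
    (Filter.Eventually.of_forall fun ξ => ?_)
  refine (T _).le_of_opNorm_le ?_ x
  rcases lt_or_ge (s * (ξ : ℝ)) a with h | h
  · exact (hC _ (mul_pos hs ξ.2) h).trans (le_max_left _ _)
  · exact (hC' _ h).trans (le_max_right _ _)

theorem exists_clm_eq_functionalCalculus [CompleteSpace X] {μ : SignedMeasure (Ioi (0 : ℝ))}
    {T : ℝ → X →L[ℂ] X} {s : ℝ} (h : IsFunctionalCalculusDefined μ T s) :
    ∃ B : X →L[ℂ] X, ∀ x, B x = functionalCalculus μ T s x := by
  obtain ⟨B₁, hB₁⟩ := exists_clm_eq_integral μ.toJordanDecomposition.posPart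
    (fun ξ : Ioi (0 : ℝ) => T (s * (ξ : ℝ))) fun x => SignedMeasure.integrable_posPart (h x)
  obtain ⟨B₂, hB₂⟩ := exists_clm_eq_integral μ.toJordanDecomposition.negPart
    (fun ξ : Ioi (0 : ℝ) => T (s * (ξ : ℝ))) fun x => SignedMeasure.integrable_negPart (h x)
  refine ⟨B₁ - B₂, fun x => ?_⟩
  rw [sub_apply, hB₁, hB₂]
  exact (μ.integral_eq_sub (h x)).symm

/-- `F(-sA)` acts on the exponential transform `J(z) = ∫ e^{zt} T(t + δ)x dt` of an orbit as the
multiplication by `F(sz)`, up to an error which is bounded uniformly in `s` and `z`. -/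
theorem norm_laplaceTransform_smul_sub_functionalCalculus_le [CompleteSpace X]
    {μ : SignedMeasure (Ioi (0 : ℝ))} {T : ℝ → X →L[ℂ] X} (hT : IsStronglyContinuousSemigroup T)
    {δ : ℝ} (hδ : 0 < δ) {x : X} {f : ℝ → X} (hf : f = fun t => T (t + δ) x)
    (hfc : ContinuousOn f (Ici 0))
    (hdecay : ∀ ω : ℝ, ∃ C : ℝ, ∀ t : ℝ, 0 ≤ t → ‖f t‖ ≤ C * Real.exp (-ω * t))
    {s : ℝ} (hs : 0 < s) (h : IsFunctionalCalculusDefined μ T s) {z : ℂ} (hz : 0 ≤ z.re) :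
    ‖laplaceTransform μ (s * z) • (∫ t in Ioi (0 : ℝ), Complex.exp (z * t) • f t) -
      functionalCalculus μ T s (∫ t in Ioi (0 : ℝ), Complex.exp (z * t) • f t)‖ ≤
    (∫ t in Ioi (0 : ℝ), ‖f t‖) * (μ.toJordanDecomposition.posPart.real univ +
      μ.toJordanDecomposition.negPart.real univ) := by
  set J : X := ∫ t in Ioi (0 : ℝ), Complex.exp (z * t) • f t with hJ
  have hsz : 0 ≤ ((s : ℂ) * z).re := by
    rw [Complex.re_ofReal_mul]
    exact mul_nonneg hs.le hz
  have hTJ : ∀ a : ℝ, 0 < a →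
      T a J = ∫ t in Ioi (0 : ℝ), Complex.exp (z * t) • f (t + a) := by
    intro a ha
    rw [hJ, ← (T a).integral_comp_comm (integrableOn_exp_smul_of_decay hfc hdecay z)]
    refine setIntegral_congr_fun measurableSet_Ioi fun t ht => ?_
    have ht0 : (0 : ℝ) < t := ht
    simp only [map_smul, hf]
    rw [show t + a + δ = a + (t + δ) by ring, hT.map_add a (t + δ) ha (by linarith)]
    rfl
  -- The error is the same constant for every `ξ`, so it integrates against the finite Jordan parts
  -- of `μ`.
  have hk : ∀ ξ : Ioi (0 : ℝ),
      ‖Complex.exp (-((s * z) * ((ξ : ℝ) : ℂ))) • J - T (s * (ξ : ℝ)) J‖ ≤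
        ∫ t in Ioi (0 : ℝ), ‖f t‖ := by
    intro ξ
    have hξ : 0 < s * (ξ : ℝ) := mul_pos hs ξ.2
    have := norm_exp_neg_smul_integral_sub_shift_le hfc hdecay hz hξ.le
    rw [hTJ _ hξ]
    convert this using 5
    push_cast
    ring
  have hpart : ∀ (ρ : Measure (Ioi (0 : ℝ))) [IsFiniteMeasure ρ],
      Integrable (fun ξ : Ioi (0 : ℝ) => T (s * (ξ : ℝ)) J) ρ →
      ‖(∫ ξ : Ioi (0 : ℝ), Complex.exp (-((s * z) * ((ξ : ℝ) : ℂ))) ∂ρ) • J -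
        ∫ ξ : Ioi (0 : ℝ), T (s * (ξ : ℝ)) J ∂ρ‖ ≤ (∫ t in Ioi (0 : ℝ), ‖f t‖) * ρ.real univ := by
    intro ρ _ hρ
    rw [← integral_smul_const, ← integral_sub ((integrable_exp_neg_mul hsz).smul_const J) hρ]
    exact norm_integral_le_of_norm_le_const (Filter.Eventually.of_forall hk)
  have h1 := hpart _ (SignedMeasure.integrable_posPart (h J))
  have h2 := hpart _ (SignedMeasure.integrable_negPart (h J))
  rw [laplaceTransform_eq_sub μ hsz, functionalCalculus, μ.integral_eq_sub (h J), mul_add]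
  refine le_trans ?_ (add_le_add h1 h2)
  refine le_trans (le_of_eq ?_) (norm_sub_le _ _)
  congr 1
  rw [sub_smul]
  abel

end Semigroup

/-! ### The rescaling argument and the theorem. -/

/-- The geometric bound of `exists_halfDisc_uniform_bound` for the Laplace transform of a signed
measure at a positive point where its modulus attains its maximum on `[0, ∞)`. -/
theorem exists_halfDisc_uniform_bound_laplaceTransform {μ : SignedMeasure (Ioi (0 : ℝ))}
    (hμ : μ ≠ 0) {x₀ : ℝ} (hx₀ : 0 < x₀) (hpos : 0 < ‖laplaceTransform μ x₀‖)
    (hmax : ∀ x : ℝ, 0 ≤ x → ‖laplaceTransform μ x‖ ≤ ‖laplaceTransform μ x₀‖) :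
    ∃ r C : ℝ, 0 < r ∧ ∀ (E : Type*) [NormedAddCommGroup E] [NormedSpace ℂ E] (h : ℂ → E)
      (B : ℝ), Differentiable ℂ h → 0 ≤ B → (∀ z : ℂ, z.re = 0 → ‖h z‖ ≤ B) →
      (∀ z : ℂ, 0 ≤ z.re → ‖laplaceTransform μ x₀‖ < ‖laplaceTransform μ z‖ →
        ‖h z‖ * (‖laplaceTransform μ z‖ - ‖laplaceTransform μ x₀‖) ≤ B) →
      ∀ z : ℂ, 0 < z.re → ‖z‖ < r → ‖h z‖ ≤ C * B := by
  have hreal : ((laplaceTransform μ x₀).re : ℂ) = laplaceTransform μ x₀ := by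
    rw [← Complex.conj_eq_iff_re, ← laplaceTransform_conj μ (by simpa using hx₀.le),
      Complex.conj_ofReal]
  -- A sign normalises the real value at `x₀` to be positive without changing any modulus.
  obtain ⟨σ, hσ, hσF⟩ : ∃ σ : ℝ, |σ| = 1 ∧
      (σ : ℂ) * laplaceTransform μ x₀ = (‖laplaceTransform μ x₀‖ : ℝ) := by
    rw [← hreal, Complex.norm_real, Real.norm_eq_abs]
    rcases abs_cases (laplaceTransform μ x₀).re with ⟨h, -⟩ | ⟨h, -⟩
    · exact ⟨1, by simp, by rw [h]; simp⟩
    · exact ⟨-1, by simp, by rw [h]; simp⟩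
  have hσ0 : (σ : ℂ) ≠ 0 := by
    rw [Complex.ofReal_ne_zero]
    rintro rfl
    simp at hσ
  have hnorm : ∀ z, ‖(σ : ℂ) * laplaceTransform μ z‖ = ‖laplaceTransform μ z‖ := fun z => by
    rw [norm_mul, Complex.norm_real, Real.norm_eq_abs, hσ, one_mul]
  have h := exists_halfDisc_uniform_bound (F := fun z => (σ : ℂ) * laplaceTransform μ z) hpos
    ((differentiableOn_laplaceTransform μ).const_mul _)
    (continuousOn_const.mul (continuousOn_laplaceTransform μ))
    (fun z hz => (hnorm z).le.trans (norm_laplaceTransform_le μ hz))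
    (fun x hx => (hnorm x).le.trans (hmax x hx))
    (fun z hz => by rw [laplaceTransform_conj μ hz, map_mul, Complex.conj_ofReal])
    hx₀ hσF (fun hev => hμ ?_)
  · simpa only [hnorm] using h
  · refine eq_zero_of_laplaceTransform_eventually_const (z₀ := (x₀ : ℂ))
      (c := (‖laplaceTransform μ x₀‖ : ℝ) / (σ : ℂ)) (by simpa using hx₀) ?_
    filter_upwards [hev] with z hz
    rw [eq_div_iff hσ0, mul_comm, hz]

/-- If `‖F(-sA)‖` does not exceed the maximum of `|F|` for arbitrarily small `s`, then the
quasinilpotent semigroup `T` vanishes. -/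
theorem eq_zero_of_frequently_norm_le {X : Type*} [NormedAddCommGroup X] [NormedSpace ℂ X]
    [CompleteSpace X] {μ : SignedMeasure (Ioi (0 : ℝ))} (hμ : μ ≠ 0) {T : ℝ → X →L[ℂ] X}
    (hT : IsStronglyContinuousSemigroup T) (hq : IsQuasinilpotentSemigroup T) {x₀ : ℝ}
    (hx₀ : 0 < x₀) (hpos : 0 < ‖laplaceTransform μ x₀‖)
    (hmax : ∀ x : ℝ, 0 ≤ x → ‖laplaceTransform μ x‖ ≤ ‖laplaceTransform μ x₀‖)
    (hsmall : ∀ η : ℝ, 0 < η → ∃ s : ℝ, 0 < s ∧ s ≤ η ∧ IsFunctionalCalculusDefined μ T s ∧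
      ∀ x : X, ‖functionalCalculus μ T s x‖ ≤ ‖laplaceTransform μ x₀‖ * ‖x‖)
    {t₀ : ℝ} (ht₀ : 0 < t₀) : T t₀ = 0 := by
  ext x
  set M : ℝ := ‖laplaceTransform μ x₀‖ with hM
  obtain ⟨r, C, hr, hbound⟩ := exists_halfDisc_uniform_bound_laplaceTransform hμ hx₀ hpos hmax
  -- The offset keeps the orbit away from the uncontrolled origin, and `f δ = T t₀ x` is the value
  -- to be shown zero.
  set δ : ℝ := t₀ / 2 with hδ
  have hδ0 : 0 < δ := by positivity
  set f : ℝ → X := fun t => T (t + δ) x with hf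
  have hfc : ContinuousOn f (Ici 0) :=
    (hT.continuousOn x).comp (by fun_prop) fun t ht => by
      have : (0 : ℝ) ≤ t := ht
      exact add_pos_of_nonneg_of_pos this hδ0
  have hdecay : ∀ ω : ℝ, ∃ C : ℝ, ∀ t : ℝ, 0 ≤ t → ‖f t‖ ≤ C * Real.exp (-ω * t) := by
    intro ω
    obtain ⟨C, -, hC⟩ := hT.exists_norm_le_exp hq hδ0 ω
    refine ⟨C * Real.exp (-ω * δ) * ‖x‖, fun t ht => ?_⟩
    refine ((T _).le_of_opNorm_le (hC (t + δ) (by linarith)) x).trans (le_of_eq ?_)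
    rw [mul_add, Real.exp_add]
    ring
  set J : ℂ → X := fun z => ∫ t in Ioi (0 : ℝ), Complex.exp (z * t) • f t with hJ
  have hJd : Differentiable ℂ J := differentiable_integral_exp_smul hfc hdecay
  set L : ℝ := ∫ t in Ioi (0 : ℝ), ‖f t‖ with hL
  have hL0 : 0 ≤ L := integral_nonneg fun _ => norm_nonneg _
  set N : ℝ := μ.toJordanDecomposition.posPart.real univ +
    μ.toJordanDecomposition.negPart.real univ with hN
  have hN0 : 0 ≤ N := add_nonneg measureReal_nonneg measureReal_nonneg
  have hJleft : ∀ z : ℂ, z.re ≤ 0 → ‖J z‖ ≤ L := fun z hz =>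
    norm_integral_exp_smul_le (integrableOn_of_decay hfc hdecay) hz
  set B : ℝ := max L (L * N) with hB
  have hB0 : 0 ≤ B := hL0.trans (le_max_left _ _)
  have hJright : ∀ w : ℂ, 0 < w.re → ‖J w‖ ≤ C * B := by
    intro w hw
    -- This choice puts `s * w` in the half-disc, where the bound for `z ↦ J (z / s)` does not
    -- depend on `s`; its value at `s * w` is `J w`.
    obtain ⟨s, hs, hsη, hdef, hnorm⟩ := hsmall (r / (‖w‖ + 1)) (by positivity)
    have hs' : (s : ℂ) ≠ 0 := Complex.ofReal_ne_zero.2 hs.ne'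
    have hre : ∀ z : ℂ, (z / s).re = z.re / s := fun z => Complex.div_ofReal_re z s
    have h := hbound X (fun z => J (z / s)) B (hJd.comp (by fun_prop)) hB0
      (fun z hz => (hJleft _ (by rw [hre, hz, zero_div])).trans (le_max_left _ _))
      (fun z hz hzM => by
        have h1 := norm_laplaceTransform_smul_sub_functionalCalculus_le hT hδ0 hf hfc hdecay hs
          hdef (z := z / s) (by rw [hre]; positivity)
        rw [mul_div_cancel₀ z hs'] at h1
        have h2 := norm_sub_norm_le (laplaceTransform μ z • J (z / s))
          (functionalCalculus μ T s (J (z / s)))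
        rw [norm_smul] at h2
        have h3 := hnorm (J (z / s))
        have h4 : L * N ≤ B := le_max_right _ _
        have h5 := h2.trans h1
        linarith)
      (s * w) (by rw [Complex.re_ofReal_mul]; positivity) (by
        rw [norm_mul, Complex.norm_real, Real.norm_eq_abs, abs_of_pos hs]
        rw [le_div_iff₀ (by positivity)] at hsη
        linarith)
    simpa [mul_div_cancel_left₀ w hs'] using h
  have h := eq_zero_of_integral_exp_smul_bounded hfc hdecay (S := T)
    (fun a t ha ht => by
      simp only [hf]
      rw [show t + a + δ = a + (t + δ) by ring, hT.map_add a (t + δ) ha (by linarith)]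
      rfl)
    (C := max L (C * B)) (fun z => by
      rcases le_or_gt z.re 0 with hz | hz
      · exact (hJleft z hz).trans (le_max_left _ _)
      · exact (hJright z hz).trans (le_max_right _ _)) hδ0
  have hδδ : δ + δ = t₀ := by
    rw [hδ]
    ring
  simpa [hf, hδδ] using h

theorem theorem3p1 {X : Type*} [NormedAddCommGroup X] [NormedSpace ℂ X] [CompleteSpace X]
    (μ : SignedMeasure (Ioi (0 : ℝ))) (hμ : μ ≠ 0) (hμ_total : μ univ = 0)
    (T : ℝ → X →L[ℂ] X) (hT : IsStronglyContinuousSemigroup T)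
    (hT_quasinilpotent : IsQuasinilpotentSemigroup T) (hT_nontrivial : ∃ t : ℝ, 0 < t ∧ T t ≠ 0) :
    -- `F(-sA)` exists for all `s > 0` if `μ` vanishes near `0` or `T` is bounded near `0`
    (((∃ a : ℝ, 0 < a ∧ μ.variation {ξ : Ioi (0 : ℝ) | (ξ : ℝ) < a} = 0) ∨
        (∃ a C : ℝ, 0 < a ∧ ∀ t : ℝ, 0 < t → t < a → ‖T t‖ ≤ C)) →
      ∀ s : ℝ, 0 < s → IsFunctionalCalculusDefined μ T s) ∧
    -- `M` is the maximum of `|F|` on `[0, ∞)`, and `B = F(-sA)`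
    ∃ M : ℝ, IsGreatest ((fun x : ℝ => ‖laplaceTransform μ (x : ℂ)‖) '' Ici 0) M ∧
      ∃ η : ℝ, 0 < η ∧ ∀ s : ℝ, 0 < s → s ≤ η → IsFunctionalCalculusDefined μ T s →
        ∃ B : X →L[ℂ] X, (∀ x : X, B x = functionalCalculus μ T s x) ∧ M < ‖B‖ := by
  refine ⟨?_, ?_⟩
  · rintro (⟨a, ha, h⟩ | ⟨a, C, ha, h⟩) s hs
    · exact isFunctionalCalculusDefined_of_variation_eq_zero hT hT_quasinilpotent ha h hs
    · exact isFunctionalCalculusDefined_of_bounded_near_zero hT hT_quasinilpotent ha h hs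
  obtain ⟨x₀, hx₀, hpos, hmax⟩ := exists_isGreatest_norm_laplaceTransform hμ hμ_total
  refine ⟨‖laplaceTransform μ x₀‖, ⟨⟨x₀, hx₀.le, rfl⟩, ?_⟩, ?_⟩
  · rintro _ ⟨x, hx, rfl⟩
    exact hmax x hx
  by_contra! hcon
  obtain ⟨t₀, ht₀, hne⟩ := hT_nontrivial
  refine hne (eq_zero_of_frequently_norm_le hμ hT hT_quasinilpotent hx₀ hpos hmax ?_ ht₀)
  intro η hη
  obtain ⟨s, hs, hsη, hdef, hB⟩ := hcon η hη
  obtain ⟨B, hBF⟩ := exists_clm_eq_functionalCalculus hdef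
  exact ⟨s, hs, hsη, hdef, fun x => by
    rw [← hBF]
    exact B.le_of_opNorm_le (hB B hBF) x⟩
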